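/- **Plant.** An $n$-joint rigid manipulator satisfies $M(q)\ddot q+C(q,\dot q)\dot q+G(q)+\tau_d(t)=u+\tau_h$, $\tau_h=J(q)^\top F_h(t)$, with $M,C,G$ continuous, $M(q)$ symmetric positive definite, smooth forward kinematics $z=h_z(q)\in\mathbb R^6$ and $J=Dh_z$. A nominal model $\hat M,\hat C,\hat G$ ($\hat M(q)$ positive definite) is available; $\tilde X=\hat X-X$. Let $x=(q,\dot q)$. **Impedance trajectory.** With $M_d,B_d,K_d$ symmetric positive definite, $z_{\rm imp}$ solves $M_d\ddot e+B_d\dot e+K_d e=F_h$, $e=z_d-z_{\rm imp}$. With a thin singular value decomposition $J(q_{\rm imp})=U\Sigma V^\top$, $J^\dagger=V\Sigma(\Sigma^2+K_\lambda)^{-1}U^\top$, $K_\lambda={\rm diag}\big(2k_{\max}/(1+e^{\alpha_s\sigma_i})\big)$, let $\ddot q_{\rm imp}=J^\dagger(\bar a-\dot J\dot q_{\rm imp})-(I-J^\dagger J)K_{\rm damp}\dot q_{\rm imp}$, $\bar a=\ddot z_{\rm imp}-\sum_i w_i(u_i^\top\ddot z_{\rm imp})u_i$, where $u_i$ are the columns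 of $U$ and $w_i=0$ if $\sigma_i\ge\bar\sigma$, $1$ if $\sigma_i\le\underline\sigma$, and $\frac12(1+\cos(\pi\frac{\sigma_i-\underline\sigma}{\bar\sigma-\underline\sigma}))$ otherwise; $k_{\max},\alpha_s>0$, $\underline\sigma<\bar\sigma$, $K_{\rm damp}$ positive definite. **Safe set.** All joints have velocity limits $\dot q_{\max,i}>0$; those in $\mathcal J_p$ also have position limits $q_{\max,i}>0$, and $\mathcal J_v$ is the set of the others. Let $R_1(s)=\max\{0,s\}$, $R_2(s)=\max\{0,-s\}$, $l\ge2$ even, ${}^ih_{v1,v2}=\dot q_{\max,i}\mp\dot q_i$, ${}^ih_{pj}=1-R_j^l(q_i/q_{\max,i})-R_j(\dot q_i/\dot q_{\max,i})$, and $$\mathcal C^*=\{x:\ \min_j{}^ih_{vj}\ge0\ (i\in\mathcal J_v),\ \min_j{}^ih_{pj}\ge0\ (i\in\mathcal J_p)\}.$$ For $i\in\mathcal J_v$ put $\alpha_{A,i}=-\gamma_v\,{}^ih_{v2}$, $\alpha_{B,i}=\gamma_v\,{}^ih_{v1}$ and $\mu_i=\frac{\bar\omega_1^2}{2\nu\beta}+\frac{\beta}{4\alpha_o-2(\nu+\gamma_v)}$.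 For $i\in\mathcal J_p$ put $\alpha_{A,i}=\dot q_{\max,i}\big(-l\frac{\dot q_i}{q_{\max,i}}R_2^{l-1}(\frac{q_i}{q_{\max,i}})-\gamma_p\,{}^ih_{p2}\big)$, $\alpha_{B,i}=\dot q_{\max,i}\big(-l\frac{\dot q_i}{q_{\max,i}}R_1^{l-1}(\frac{q_i}{q_{\max,i}})+\gamma_p\,{}^ih_{p1}\big)$ and $\mu_i=\frac{\bar\omega_1^2\dot q_{\max,i}}{2\nu\beta}+\frac{\beta/\dot q_{\max,i}}{4\alpha_o-2(\nu+\gamma_p)}$. Here $\alpha_o,\beta,\bar\omega_1,\gamma_v,\gamma_p>0$, $0<\nu<2\alpha_o$, $\max\{\gamma_v,\gamma_p\}<2\alpha_o-\nu$. **Controller.** Let $\Lambda,K_r$ be positive diagonal, $K_v=\Lambda+K_r$, $K_p=K_r\Lambda$, and $$\ddot q_{\rm ref}=\ddot q_{\rm cmd}+K_v(\dot q-\dot q_{\rm ref})+K_p(q-q_{\rm ref}),\qquad r=(\dot q_{\rm ref}-\dot q)+\Lambda(q_{\rm ref}-q).$$ Let $\ddot q_{s,i}=\hat w_i\tanh(\frac{\kappa}{\varepsilon_i}r_i\hat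 w_i)$ with $\varepsilon_i,\kappa>0$, $\kappa+\ln\kappa=-1$. The disturbance observers are $\hat d_c=\ell_c+\alpha_c\dot q$, $\hat d_o=\ell_o+\alpha_o\dot q$ with $\alpha_c>0$, $\dot\ell_c=-\alpha_c(\ddot q_{\rm cmd}+\ddot q_s)$, $\dot\ell_o=-\alpha_o(\ddot q_{\rm cmd}+\ddot q_s+\hat d_o)$. Let $\bar\xi=\ddot q_s-\hat d_c$, $\xi=(q,\dot q,\bar\xi)$, and let $\hat f(\xi;\theta)=\zeta(\xi)^\top\theta$ be joint-wise interval type-2 Takagi–Sugeno–Kang fuzzy systems with Gaussian memberships, product inference and Nie–Tan type reduction, with inputs $(\sin q_i,\cos q_i,\dot q_i,\bar\xi_i)$. The update laws are $$\dot\theta={\rm Proj}_{\Gamma_\theta}(\theta,-\zeta(\xi)r,f_\Theta),\qquad \dot{\hat w}=\Gamma_w|r|-\sigma_w\Gamma_w\hat w,\qquad f_\Theta(\theta)=\frac{\|\theta\|^2-\Theta^2}{2\varepsilon\Theta+\varepsilon^2},$$ with $\Gamma_\theta={\rm diag}(\gamma_{\theta i})\otimes I$ and $\Gamma_w$ positive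 diagonal, $\sigma_w,\Theta,\varepsilon>0$, and where ${\rm Proj}_\Gamma(\theta,y,f)=\Gamma y-f(\theta)\,\Gamma\frac{\nabla f\nabla f^\top}{\nabla f^\top\Gamma\nabla f}\Gamma y$ if $f(\theta)>0$ and $y^\top\Gamma\nabla f(\theta)>0$, and $\Gamma y$ otherwise. Let $\tau_{\rm base}=\tau_h-\hat C\dot q-\hat G-\hat M(\ddot q_s-\hat d_c-\hat f)$ and $\ddot q_{\rm nom}=\ddot q_{\rm imp}+K_v(\dot q_{\rm imp}-\dot q)+K_p(q_{\rm imp}-q)$. At each time, $(\ddot q_{\rm cmd},s^*)$ minimises $\frac12\|a-\ddot q_{\rm nom}\|^2+\rho\mathbf 1^\top s+\frac{\varepsilon_s}2\|s\|^2$ ($\rho,\varepsilon_s>0$) subject to $$\alpha_A-\ddot q_s-\hat d_o+\mu\le a\le\alpha_B-\ddot q_s-\hat d_o-\mu,\qquad \tau_{\min}-s\le\hat Ma-\tau_{\rm base}\le\tau_{\max}+s,\qquad s\ge0,$$ and the torque is $u=\hat M\ddot q_{\rm cmd}-\tau_{\rm base}$. Let $\mathcal F(x)$ be the set of wrenches $F_h$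 for which these constraints are feasible with $s=0$ (the other controller states being given). **Assumptions**, along classical solutions of the closed loop on $[0,\infty)$: 1. $z_d$ is $C^2$, and $z_d,\dot z_d,\ddot z_d$ are bounded by a given constant; $\tau_d$ is bounded and Lipschitz; $F_h$ is continuous and bounded by a given constant. 2. $\xi(t)\in\Omega$ for a given compact $\Omega\subset\mathbb R^{3n}$, on which $D(\xi)=M^{-1}(\tilde M\bar\xi+\tilde C\dot q+\tilde G)=f(\xi)+g(\xi)$, where $f_i$ depends only on $(q_i,\dot q_i,\bar\xi_i)$. 3. Let $\theta^*$ minimise $\sup_{\xi\in\Omega}\|f(\xi)-\hat f(\xi;\theta)\|^2$, and let $\delta=M^{-1}\big(\tau_d-\tilde M(\ddot q_{\rm cmd}-\hat f)\big)$, $\bar\delta=\delta-g(\xi)$, $d=f(\xi)-\hat f(\xi;\theta^*)-\bar\delta$ and $d_{\rm CBF}=f(\xi)-\hat f(\xi;\theta)-\bar\delta-\hat d_c$. Then $\|\theta^*\|\le\Theta$, $\|d\|\le\omega_0$, $\|d_{\rm CBF}\|\le\bar\omega_0$, and the rates of change of $d$ and $d_{\rm CBF}$ are bounded by $\omega_1$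 and $\bar\omega_1$ (as Lipschitz constants). Moreover $\hat d_o(0)=d_{\rm CBF}(0)$. 4. For all $t>0$, $F_h(t)\in\mathcal F(x(t))$, and $\rho$ exceeds the components of an optimal Lagrange multiplier for the torque constraints of the hard-constrained ($s=0$) problem. **Theorem.** For all such solutions: (i) $u(t)\in\mathcal U=[\tau_{\min},\tau_{\max}]$ for all $t\ge0$. (ii) If $x(0)\in\mathcal C^*$, then $x(t)\in\mathcal C^*$ for all $t\ge0$. (iii) The impedance tracking error $z_{\rm imp}-z$ is uniformly ultimately bounded: there is $b>0$, depending only on the plant, the controller, $\Omega$ and the given bounds, such that for every $a>0$ there is $T\ge0$ with $\|z_{\rm imp}(t)-z(t)\|\le b$ for all $t\ge T$ and every such solution with $\|(z_{\rm imp}-z)(0)\|\le a$ and $\|(\dot z_{\rm imp}-\dot z)(0)\|\le a$. -/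

import Mathlib

open Set
open scoped Matrix Kronecker ContDiff

noncomputable section

namespace SafeImpedance

/-- Column vectors with the Euclidean norm. -/
abbrev Vec (k : ℕ) := EuclideanSpace ℝ (Fin k)

/-- The matrix-vector product on Euclidean vectors. -/
def act {ι κ : Type} [Fintype κ] (A : Matrix ι κ ℝ) (x : EuclideanSpace ℝ κ) :
    EuclideanSpace ℝ ι :=
  WithLp.toLp 2 (A *ᵥ x.ofLp)

/-! ### The soft-constrained quadratic programme -/

/-- Data of the QP at one instant: nominal acceleration, hard acceleration box `[lo, hi]`, inertia
matrix, base torque, torque box, penalty weight and slack regularisation. -/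
structure QPData (n : ℕ) where
  nom : Vec n
  lo : Vec n
  hi : Vec n
  H : Matrix (Fin n) (Fin n) ℝ
  base : Vec n
  tmin : Vec n
  tmax : Vec n
  rho : ℝ
  eps : ℝ

namespace QPData

variable {n : ℕ} (D : QPData n)

/-- The hard (barrier) constraint on the acceleration. -/
def InBox (a : Vec n) : Prop := ∀ i, D.lo i ≤ a i ∧ a i ≤ D.hi i

/-- The torque that the acceleration `a` requires. -/
def torque (a : Vec n) : Vec n := act D.H a - D.base

/-- Feasible set of the soft-constrained problem, in the variables `(a, s)`. -/
def softFeasible : Set (Vec n × Vec n) :=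
  {p | D.InBox p.1 ∧
    (∀ i, D.tmin i - p.2 i ≤ D.torque p.1 i ∧ D.torque p.1 i ≤ D.tmax i + p.2 i) ∧
    ∀ i, 0 ≤ p.2 i}

/-- Cost of the soft-constrained problem. -/
def softCost (p : Vec n × Vec n) : ℝ :=
  1 / 2 * ‖p.1 - D.nom‖ ^ 2 + D.rho * ∑ i, p.2 i + D.eps / 2 * ‖p.2‖ ^ 2

/-- `(a, s)` solves the soft-constrained problem. -/
def IsSoftSolution (a s : Vec n) : Prop :=
  (a, s) ∈ D.softFeasible ∧ IsMinOn D.softCost D.softFeasible (a, s)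

/-- Feasible set of the hard-constrained problem (`s = 0`). -/
def hardFeasible : Set (Vec n) :=
  {a | D.InBox a ∧ ∀ i, D.tmin i ≤ D.torque a i ∧ D.torque a i ≤ D.tmax i}

/-- `a` solves the hard-constrained problem (`s = 0`). -/
def IsHardSolution (a : Vec n) : Prop :=
  a ∈ D.hardFeasible ∧ IsMinOn (fun b => 1 / 2 * ‖b - D.nom‖ ^ 2) D.hardFeasible a

/-- `(mlo, mhi, llo, lhi)` are Karush-Kuhn-Tucker multipliers of the hard-constrained problem at
`a`, for the lower and upper acceleration bounds and the lower and upper torque bounds. -/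
structure IsMultiplier (a mlo mhi llo lhi : Vec n) : Prop where
  nonneg : ∀ i, 0 ≤ mlo i ∧ 0 ≤ mhi i ∧ 0 ≤ llo i ∧ 0 ≤ lhi i
  stationary : a - D.nom - mlo + mhi + act D.Hᵀ (lhi - llo) = 0
  slack_lo : ∀ i, mlo i * (a i - D.lo i) = 0
  slack_hi : ∀ i, mhi i * (D.hi i - a i) = 0
  slack_tlo : ∀ i, llo i * (D.torque a i - D.tmin i) = 0
  slack_thi : ∀ i, lhi i * (D.tmax i - D.torque a i) = 0

/-- The penalty weight exceeds the optimal Lagrange multiplier of the torque constraints in the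
hard-constrained problem. -/
def PenaltyExceedsMultiplier : Prop :=
  ∀ a, D.IsHardSolution a →
    ∃ mlo mhi llo lhi, D.IsMultiplier a mlo mhi llo lhi ∧ ∀ i, llo i < D.rho ∧ lhi i < D.rho

end QPData

/-! ### Smooth projection operator -/

open Classical in
/-- The operator `Proj_Γ(θ, y, f)`. -/
def projOp {ι : Type} [Fintype ι] (Γ : Matrix ι ι ℝ) (θ y : EuclideanSpace ℝ ι)
    (f : EuclideanSpace ℝ ι → ℝ) : EuclideanSpace ℝ ι :=
  if 0 < f θ ∧ 0 < inner ℝ y (act Γ (gradient f θ)) then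
    act Γ y -
      (f θ * (inner ℝ (gradient f θ) (act Γ y) / inner ℝ (gradient f θ) (act Γ (gradient f θ)))) •
        act Γ (gradient f θ)
  else act Γ y

/-! ### Interval type-2 fuzzy system with Gaussian memberships and Nie-Tan type reduction -/

/-- A Gaussian interval type-2 fuzzy set: common centre, lower and upper width, height of the lower
membership function. -/
structure IT2Gaussian where
  center : ℝ
  widthLo : ℝ
  widthUp : ℝ
  height : ℝ
  widthLo_pos : 0 < widthLo
  width_le : widthLo ≤ widthUp
  height_pos : 0 < height
  height_le : height ≤ 1

def IT2Gaussian.upper (μ : IT2Gaussian) (x : ℝ) : ℝ :=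
  Real.exp (-(x - μ.center) ^ 2 / (2 * μ.widthUp ^ 2))

def IT2Gaussian.lower (μ : IT2Gaussian) (x : ℝ) : ℝ :=
  μ.height * Real.exp (-(x - μ.center) ^ 2 / (2 * μ.widthLo ^ 2))

/-- Type-reduced (Nie-Tan) normalised firing strength of rule `k` in a base of `R` rules with four
inputs and product inference. -/
def firing {R : ℕ} (mf : Fin R → Fin 4 → IT2Gaussian) (k : Fin R) (v : Fin 4 → ℝ) : ℝ :=
  ((∏ c, (mf k c).lower (v c)) + ∏ c, (mf k c).upper (v c)) /
    ∑ k', ((∏ c, (mf k' c).lower (v c)) + ∏ c, (mf k' c).upper (v c))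

/-! ### Plant -/

/-- A rigid manipulator: inertia, Coriolis and gravity terms, and smooth forward kinematics. -/
structure Plant (n : ℕ) where
  M : Vec n → Matrix (Fin n) (Fin n) ℝ
  C : Vec n → Vec n → Matrix (Fin n) (Fin n) ℝ
  G : Vec n → Vec n
  hz : Vec n → Vec 6
  M_posDef : ∀ q, (M q).PosDef
  M_cont : Continuous M
  C_cont : Continuous fun p : Vec n × Vec n => C p.1 p.2
  G_cont : Continuous G
  hz_smooth : ContDiff ℝ ∞ hz

/-- The manipulator Jacobian, the matrix of the derivative of the forward kinematics. -/
def Plant.J {n : ℕ} (P : Plant n) (q : Vec n) : Matrix (Fin 6) (Fin n) ℝ :=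
  Matrix.of fun a j => fderiv ℝ P.hz q (EuclideanSpace.single j 1) a

/-- The vector `J̇ q̇`, for the Jacobian along a curve through `q` with velocity `qd`. -/
def Plant.JdotQdot {n : ℕ} (P : Plant n) (q qd : Vec n) : Vec 6 :=
  fderiv ℝ (fderiv ℝ P.hz) q qd qd

/-- A (thin) singular value decomposition `J = U diag(σ) Vᵀ`. -/
structure IsSVD {n : ℕ} (J : Matrix (Fin 6) (Fin n) ℝ) (U : Matrix (Fin 6) (Fin 6) ℝ)
    (σ : Fin 6 → ℝ) (V : Matrix (Fin n) (Fin 6) ℝ) : Prop where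
  U_orth : Uᵀ * U = 1
  V_orth : Vᵀ * V = 1
  nonneg : ∀ i, 0 ≤ σ i
  eq : J = U * Matrix.diagonal σ * Vᵀ

/-! ### Controller -/

/-- All design parameters of the controller for `n` joints, a fuzzy system with `R` rules per joint
and `m` consequent parameters per rule. -/
structure Controller (n R m : ℕ) where
  /-- nominal rigid-body model -/
  Mhat : Vec n → Matrix (Fin n) (Fin n) ℝ
  Chat : Vec n → Vec n → Matrix (Fin n) (Fin n) ℝ
  Ghat : Vec n → Vec n
  Mhat_posDef : ∀ q, (Mhat q).PosDef
  /-- impedance model -/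
  Md : Matrix (Fin 6) (Fin 6) ℝ
  Bd : Matrix (Fin 6) (Fin 6) ℝ
  Kd : Matrix (Fin 6) (Fin 6) ℝ
  Md_posDef : Md.PosDef
  Bd_posDef : Bd.PosDef
  Kd_posDef : Kd.PosDef
  /-- damped least-squares inverse, singularity thresholds and null-space damping -/
  kmax : ℝ
  alphaS : ℝ
  sigLo : ℝ
  sigHi : ℝ
  Kdamp : Matrix (Fin n) (Fin n) ℝ
  kmax_pos : 0 < kmax
  alphaS_pos : 0 < alphaS
  sig_lt : sigLo < sigHi
  Kdamp_posDef : Kdamp.PosDef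
  /-- diagonals of the gains `Λ` and `K_r` -/
  lam : Fin n → ℝ
  kr : Fin n → ℝ
  lam_pos : ∀ i, 0 < lam i
  kr_pos : ∀ i, 0 < kr i
  /-- joints with position and velocity limits; the others have velocity limits only -/
  Jp : Finset (Fin n)
  qmax : Fin n → ℝ
  vmax : Fin n → ℝ
  qmax_pos : ∀ i ∈ Jp, 0 < qmax i
  vmax_pos : ∀ i, 0 < vmax i
  /-- barrier exponent and barrier rates -/
  l : ℕ
  l_even : Even l
  l_ge : 2 ≤ l
  gamV : ℝ
  gamP : ℝ
  gamV_pos : 0 < gamV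
  gamP_pos : 0 < gamP
  /-- observer gains and robust margin -/
  alphaC : ℝ
  alphaO : ℝ
  nu : ℝ
  beta : ℝ
  omb1 : ℝ
  alphaC_pos : 0 < alphaC
  alphaO_pos : 0 < alphaO
  nu_pos : 0 < nu
  nu_lt : nu < 2 * alphaO
  gam_lt : max gamV gamP < 2 * alphaO - nu
  beta_pos : 0 < beta
  omb1_pos : 0 < omb1
  /-- torque box and QP weights -/
  tmin : Vec n
  tmax : Vec n
  rho : ℝ
  epsS : ℝ
  rho_pos : 0 < rho
  epsS_pos : 0 < epsS
  /-- rule base of each joint, and consequent functions (for instance `1, v₀, v₁, v₂, v₃`) -/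
  mf : Fin n → Fin R → Fin 4 → IT2Gaussian
  cons : Fin m → (Fin 4 → ℝ) → ℝ
  cons_cont : ∀ j, Continuous (cons j)
  /-- adaptation gains, leakage, projection bound and tolerance, smoothing widths -/
  gamTheta : Fin n → ℝ
  gamW : Fin n → ℝ
  sigW : ℝ
  Theta : ℝ
  epsProj : ℝ
  epsSmc : Fin n → ℝ
  kap : ℝ
  gamTheta_pos : ∀ i, 0 < gamTheta i
  gamW_pos : ∀ i, 0 < gamW i
  sigW_pos : 0 < sigW
  Theta_pos : 0 < Theta
  epsProj_pos : 0 < epsProj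
  epsSmc_pos : ∀ i, 0 < epsSmc i
  kap_pos : 0 < kap
  kap_eq : kap + Real.log kap = -1

namespace Controller

variable {n R m : ℕ} (K : Controller n R m)

/-- Consequent weights, indexed by joint, rule and consequent parameter. -/
abbrev Weights (n R m : ℕ) := EuclideanSpace ℝ (Fin n × Fin R × Fin m)

/-! Gain matrices. -/

def Lam : Matrix (Fin n) (Fin n) ℝ := Matrix.diagonal K.lam
def Kr : Matrix (Fin n) (Fin n) ℝ := Matrix.diagonal K.kr
def Kv : Matrix (Fin n) (Fin n) ℝ := K.Lam + K.Kr
def Kp : Matrix (Fin n) (Fin n) ℝ := K.Kr * K.Lam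
def GamTheta : Matrix (Fin n × Fin R × Fin m) (Fin n × Fin R × Fin m) ℝ :=
  Matrix.diagonal K.gamTheta ⊗ₖ (1 : Matrix (Fin R × Fin m) (Fin R × Fin m) ℝ)
def GamW : Matrix (Fin n) (Fin n) ℝ := Matrix.diagonal K.gamW

/-! Impedance-to-joint map. -/

/-- The damping factor `k_max g(σ)`. -/
def damping (s : ℝ) : ℝ := K.kmax * (2 / (1 + Real.exp (K.alphaS * s)))

open Classical in
/-- The singularity weight of a singular value. -/
def singWeight (s : ℝ) : ℝ :=
  if K.sigHi ≤ s then 0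
  else if s ≤ K.sigLo then 1
  else 1 / 2 * (1 + Real.cos (Real.pi * ((s - K.sigLo) / (K.sigHi - K.sigLo))))

/-- The damped least-squares inverse `V Σ (Σ² + K_λ)⁻¹ Uᵀ`. -/
def dlsInverse (U : Matrix (Fin 6) (Fin 6) ℝ) (σ : Fin 6 → ℝ) (V : Matrix (Fin n) (Fin 6) ℝ) :
    Matrix (Fin n) (Fin 6) ℝ :=
  V * Matrix.diagonal σ *
    (Matrix.diagonal σ ^ 2 + Matrix.diagonal fun i => K.damping (σ i))⁻¹ * Uᵀ

/-- The `i`-th column of a `6 × 6` matrix. -/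
def column (U : Matrix (Fin 6) (Fin 6) ℝ) (i : Fin 6) : Vec 6 := WithLp.toLp 2 fun a => U a i

/-- Singularity-consistent task acceleration. -/
def singConsistent (U : Matrix (Fin 6) (Fin 6) ℝ) (σ : Fin 6 → ℝ) (a : Vec 6) : Vec 6 :=
  a - ∑ i, (K.singWeight (σ i) * inner ℝ (column U i) a) • column U i

/-- `qdd` is the impedance joint acceleration at `(q, qd)` for the task acceleration `a`. (It does
not depend on the choice of the singular value decomposition.) -/
def IsImpedanceAccel (P : Plant n) (q qd : Vec n) (a : Vec 6) (qdd : Vec n) : Prop :=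
  ∃ U σ V, IsSVD (P.J q) U σ V ∧
    qdd = act (K.dlsInverse U σ V) (K.singConsistent U σ a - P.JdotQdot q qd) -
      act (1 - K.dlsInverse U σ V * P.J q) (act K.Kdamp qd)

/-! Barrier functions. -/

def R1 (s : ℝ) : ℝ := max 0 s
def R2 (s : ℝ) : ℝ := max 0 (-s)

def hv1 (i : Fin n) (x : Vec n × Vec n) : ℝ := K.vmax i - x.2 i
def hv2 (i : Fin n) (x : Vec n × Vec n) : ℝ := K.vmax i + x.2 i
def hv (i : Fin n) (x : Vec n × Vec n) : ℝ := min (K.hv1 i x) (K.hv2 i x)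

def hp1 (i : Fin n) (x : Vec n × Vec n) : ℝ :=
  1 - R1 (x.1 i / K.qmax i) ^ K.l - R1 (x.2 i / K.vmax i)
def hp2 (i : Fin n) (x : Vec n × Vec n) : ℝ :=
  1 - R2 (x.1 i / K.qmax i) ^ K.l - R2 (x.2 i / K.vmax i)
def hp (i : Fin n) (x : Vec n × Vec n) : ℝ := min (K.hp1 i x) (K.hp2 i x)

/-- The safe set. -/
def Cstar : Set (Vec n × Vec n) :=
  {x | (∀ i, i ∉ K.Jp → 0 ≤ K.hv i x) ∧ ∀ i ∈ K.Jp, 0 ≤ K.hp i x}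

/-- Lower barrier acceleration bound. -/
def alphaA (x : Vec n × Vec n) : Vec n := WithLp.toLp 2 fun i =>
  if i ∈ K.Jp then
    K.vmax i * (-(K.l : ℝ) * (x.2 i / K.qmax i) * R2 (x.1 i / K.qmax i) ^ (K.l - 1)
      - K.gamP * K.hp2 i x)
  else -K.gamV * K.hv2 i x

/-- Upper barrier acceleration bound. -/
def alphaB (x : Vec n × Vec n) : Vec n := WithLp.toLp 2 fun i =>
  if i ∈ K.Jp then
    K.vmax i * (-(K.l : ℝ) * (x.2 i / K.qmax i) * R1 (x.1 i / K.qmax i) ^ (K.l - 1)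
      + K.gamP * K.hp1 i x)
  else K.gamV * K.hv1 i x

/-- Robust safety margin. -/
def margin : Vec n := WithLp.toLp 2 fun i =>
  if i ∈ K.Jp then
    K.omb1 ^ 2 * K.vmax i / (2 * K.nu * K.beta)
      + (K.beta / K.vmax i) / (4 * K.alphaO - 2 * (K.nu + K.gamP))
  else
    K.omb1 ^ 2 / (2 * K.nu * K.beta) + K.beta / (4 * K.alphaO - 2 * (K.nu + K.gamV))

/-! Fuzzy approximator. The argument is `ξ = (q, q̇, ξ̄)`. -/

/-- Inputs of the fuzzy system of joint `i`. -/
def flsInput (ξ : Vec n × Vec n × Vec n) (i : Fin n) : Fin 4 → ℝ :=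
  ![Real.sin (ξ.1 i), Real.cos (ξ.1 i), ξ.2.1 i, ξ.2.2 i]

/-- The regressor. -/
def zeta (ξ : Vec n × Vec n × Vec n) : Matrix (Fin n × Fin R × Fin m) (Fin n) ℝ :=
  Matrix.of fun p i =>
    if p.1 = i then firing (K.mf i) p.2.1 (flsInput ξ i) * K.cons p.2.2 (flsInput ξ i) else 0

/-- The approximator `ζ(ξ)ᵀ θ`. -/
def fhat (ξ : Vec n × Vec n × Vec n) (θ : Weights n R m) : Vec n := act (K.zeta ξ)ᵀ θ

/-- The convex bounding function of the projection. -/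
def bounding (θ : Weights n R m) : ℝ :=
  (‖θ‖ ^ 2 - K.Theta ^ 2) / (2 * K.epsProj * K.Theta + K.epsProj ^ 2)

/-- Structured uncertainty `D(ξ)`. -/
def structured (P : Plant n) (ξ : Vec n × Vec n × Vec n) : Vec n :=
  act (P.M ξ.1)⁻¹ (act (K.Mhat ξ.1 - P.M ξ.1) ξ.2.2
    + act (K.Chat ξ.1 ξ.2.1 - P.C ξ.1 ξ.2.1) ξ.2.1 + (K.Ghat ξ.1 - P.G ξ.1))

end Controller

open Controller

/-! ### Uncertainty decomposition and ideal weights -/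

/-- The compact operating domain `Ω`, the decomposition of the structured uncertainty on it into
joint-wise maps `f i` of `(q_i, q̇_i, ξ̄_i)` and a residual `g`, the ideal weights, and the bounds on
the disturbances. -/
structure Uncertainty {n R m : ℕ} (P : Plant n) (K : Controller n R m) where
  Om : Set (Vec n × Vec n × Vec n)
  Om_compact : IsCompact Om
  f : Fin n → ℝ × ℝ × ℝ → ℝ
  g : Vec n × Vec n × Vec n → Vec n
  decomp : ∀ ξ ∈ Om, K.structured P ξ =
    (WithLp.toLp 2 fun i => f i (ξ.1 i, ξ.2.1 i, ξ.2.2 i)) + g ξ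
  thetaStar : Weights n R m
  thetaStar_min : ∀ θ : Weights n R m,
    (⨆ ξ ∈ Om, ‖(WithLp.toLp 2 fun i => f i (ξ.1 i, ξ.2.1 i, ξ.2.2 i)) - K.fhat ξ thetaStar‖ₑ ^ 2)
      ≤ ⨆ ξ ∈ Om, ‖(WithLp.toLp 2 fun i => f i (ξ.1 i, ξ.2.1 i, ξ.2.2 i)) - K.fhat ξ θ‖ₑ ^ 2
  thetaStar_le : ‖thetaStar‖ ≤ K.Theta
  om0 : ℝ
  om1 : ℝ
  omb0 : ℝ
  om0_pos : 0 < om0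
  om1_pos : 0 < om1
  omb0_pos : 0 < omb0

/-- The joint-wise part `f(ξ)` of the structured uncertainty. -/
def Uncertainty.fvec {n R m : ℕ} {P : Plant n} {K : Controller n R m} (A : Uncertainty P K)
    (ξ : Vec n × Vec n × Vec n) : Vec n :=
  WithLp.toLp 2 fun i => A.f i (ξ.1 i, ξ.2.1 i, ξ.2.2 i)

/-! ### Closed loop -/

/-- All time signals of the closed loop; `xd`, `xdd` stand for the derivatives of `x`. -/
structure Signals (n R m : ℕ) where
  q : ℝ → Vec n
  qd : ℝ → Vec n
  qdd : ℝ → Vec n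
  qref : ℝ → Vec n
  qrefd : ℝ → Vec n
  qimp : ℝ → Vec n
  qimpd : ℝ → Vec n
  qimpdd : ℝ → Vec n
  zimp : ℝ → Vec 6
  zimpd : ℝ → Vec 6
  zimpdd : ℝ → Vec 6
  zdes : ℝ → Vec 6
  zdesd : ℝ → Vec 6
  zdesdd : ℝ → Vec 6
  theta : ℝ → Weights n R m
  what : ℝ → Vec n
  ellc : ℝ → Vec n
  ello : ℝ → Vec n
  qcmd : ℝ → Vec n
  slack : ℝ → Vec n
  Fh : ℝ → Vec 6
  taud : ℝ → Vec n

namespace Signals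

variable {n R m : ℕ} (X : Signals n R m) (P : Plant n) (K : Controller n R m)

/-- Joint state. -/
def x (t : ℝ) : Vec n × Vec n := (X.q t, X.qd t)

/-- Filtered reference-model tracking error. -/
def r (t : ℝ) : Vec n := (X.qrefd t - X.qd t) + act K.Lam (X.qref t - X.q t)

/-- Smooth sliding-mode term. -/
def qs (t : ℝ) : Vec n := WithLp.toLp 2 fun i =>
  X.what t i * Real.tanh (K.kap / K.epsSmc i * X.r K t i * X.what t i)

/-- Outputs of the compensation and of the safety disturbance observer. -/
def dhatc (t : ℝ) : Vec n := X.ellc t + K.alphaC • X.qd t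
def dhato (t : ℝ) : Vec n := X.ello t + K.alphaO • X.qd t

def xi (t : ℝ) : Vec n × Vec n × Vec n := (X.q t, X.qd t, X.qs K t - X.dhatc K t)

/-- Interaction torque of a wrench `F`. -/
def tauh (F : Vec 6) (t : ℝ) : Vec n := act (P.J (X.q t))ᵀ F

/-- Base torque when the interaction wrench is `F`. -/
def tauBase (F : Vec 6) (t : ℝ) : Vec n :=
  X.tauh P F t - act (K.Chat (X.q t) (X.qd t)) (X.qd t) - K.Ghat (X.q t)
    - act (K.Mhat (X.q t)) (X.qs K t - X.dhatc K t - K.fhat (X.xi K t) (X.theta t))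

/-- Nominal acceleration. -/
def qnom (t : ℝ) : Vec n :=
  X.qimpdd t + act K.Kv (X.qimpd t - X.qd t) + act K.Kp (X.qimp t - X.q t)

/-- Data of the QP at time `t` when the interaction wrench is `F`. -/
def qp (F : Vec 6) (t : ℝ) : QPData n where
  nom := X.qnom K t
  lo := K.alphaA (X.x t) + (-X.qs K t - X.dhato K t + K.margin)
  hi := K.alphaB (X.x t) + (-X.qs K t - X.dhato K t - K.margin)
  H := K.Mhat (X.q t)
  base := X.tauBase P K F t
  tmin := K.tmin
  tmax := K.tmax
  rho := K.rho
  eps := K.epsS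

/-- The set of admissible interaction wrenches at time `t`. -/
def admissible (t : ℝ) : Set (Vec 6) := {F | (X.qp P K F t).hardFeasible.Nonempty}

/-- Control torque. -/
def u (t : ℝ) : Vec n := act (K.Mhat (X.q t)) (X.qcmd t) - X.tauBase P K (X.Fh t) t

/-- Unstructured residual `δ`. -/
def delta (t : ℝ) : Vec n :=
  act (P.M (X.q t))⁻¹ (X.taud t
    - act (K.Mhat (X.q t) - P.M (X.q t)) (X.qcmd t - K.fhat (X.xi K t) (X.theta t)))

variable {P K} in
/-- Modified residual. -/
def deltaBar (A : Uncertainty P K) (t : ℝ) : Vec n := X.delta P K t - A.g (X.xi K t)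

variable {P K} in
/-- The disturbance `d`. -/
def d (A : Uncertainty P K) (t : ℝ) : Vec n :=
  A.fvec (X.xi K t) - K.fhat (X.xi K t) A.thetaStar - X.deltaBar A t

variable {P K} in
/-- The disturbance `d_CBF`. -/
def dCBF (A : Uncertainty P K) (t : ℝ) : Vec n :=
  A.fvec (X.xi K t) - K.fhat (X.xi K t) (X.theta t) - X.deltaBar A t - X.dhatc K t

/-- The signals form a classical solution on `[0, ∞)` of the plant in closed loop with the
controller. -/
structure IsClosedLoop : Prop where
  q_deriv : ∀ t, 0 ≤ t → HasDerivWithinAt X.q (X.qd t) (Ici 0) t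
  qd_deriv : ∀ t, 0 ≤ t → HasDerivWithinAt X.qd (X.qdd t) (Ici 0) t
  qdd_cont : ContinuousOn X.qdd (Ici 0)
  dynamics : ∀ t, 0 ≤ t →
    act (P.M (X.q t)) (X.qdd t) + act (P.C (X.q t) (X.qd t)) (X.qd t) + P.G (X.q t) + X.taud t
      = X.u P K t + X.tauh P (X.Fh t) t
  zimp_deriv : ∀ t, 0 ≤ t → HasDerivWithinAt X.zimp (X.zimpd t) (Ici 0) t
  zimpd_deriv : ∀ t, 0 ≤ t → HasDerivWithinAt X.zimpd (X.zimpdd t) (Ici 0) t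
  impedance : ∀ t, 0 ≤ t →
    act K.Md (X.zdesdd t - X.zimpdd t) + act K.Bd (X.zdesd t - X.zimpd t)
      + act K.Kd (X.zdes t - X.zimp t) = X.Fh t
  qimp_deriv : ∀ t, 0 ≤ t → HasDerivWithinAt X.qimp (X.qimpd t) (Ici 0) t
  qimpd_deriv : ∀ t, 0 ≤ t → HasDerivWithinAt X.qimpd (X.qimpdd t) (Ici 0) t
  jointMap : ∀ t, 0 ≤ t →
    K.IsImpedanceAccel P (X.qimp t) (X.qimpd t) (X.zimpdd t) (X.qimpdd t)
  qref_deriv : ∀ t, 0 ≤ t → HasDerivWithinAt X.qref (X.qrefd t) (Ici 0) t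
  qrefd_deriv : ∀ t, 0 ≤ t → HasDerivWithinAt X.qrefd
    (X.qcmd t + act K.Kv (X.qd t - X.qrefd t) + act K.Kp (X.q t - X.qref t)) (Ici 0) t
  qp_solution : ∀ t, 0 ≤ t → (X.qp P K (X.Fh t) t).IsSoftSolution (X.qcmd t) (X.slack t)
  theta_law : ∀ t, 0 ≤ t → HasDerivWithinAt X.theta
    (projOp K.GamTheta (X.theta t) (-act (K.zeta (X.xi K t)) (X.r K t)) K.bounding) (Ici 0) t
  what_law : ∀ t, 0 ≤ t → HasDerivWithinAt X.what
    (act K.GamW (WithLp.toLp 2 fun i => |X.r K t i|) - K.sigW • act K.GamW (X.what t)) (Ici 0) t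
  ellc_law : ∀ t, 0 ≤ t → HasDerivWithinAt X.ellc
    (-K.alphaC • (X.qcmd t + X.qs K t)) (Ici 0) t
  ello_law : ∀ t, 0 ≤ t → HasDerivWithinAt X.ello
    (-K.alphaO • (X.qcmd t + X.qs K t + X.dhato K t)) (Ici 0) t

/-- The task scenario: a twice continuously differentiable desired trajectory whose value, velocity
and acceleration are bounded by `zb`, a bounded Lipschitz disturbance torque, and a continuous
interaction wrench bounded by `Fb`. -/
structure IsScenario (zb Fb : ℝ) : Prop where
  zdes_deriv : ∀ t, 0 ≤ t → HasDerivWithinAt X.zdes (X.zdesd t) (Ici 0) t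
  zdesd_deriv : ∀ t, 0 ≤ t → HasDerivWithinAt X.zdesd (X.zdesdd t) (Ici 0) t
  zdesdd_cont : ContinuousOn X.zdesdd (Ici 0)
  zdes_bdd : ∀ t, 0 ≤ t → ‖X.zdes t‖ ≤ zb ∧ ‖X.zdesd t‖ ≤ zb ∧ ‖X.zdesdd t‖ ≤ zb
  taud_bdd : ∃ B, ∀ t, 0 ≤ t → ‖X.taud t‖ ≤ B
  taud_lip : ∃ L, LipschitzOnWith L X.taud (Ici 0)
  Fh_cont : ContinuousOn X.Fh (Ici 0)
  Fh_bdd : ∀ t, 0 ≤ t → ‖X.Fh t‖ ≤ Fb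

variable {P K} in
/-- The operating domain and disturbance-bound assumptions. The rates of change are bounded in the
sense of Lipschitz constants; this is the bound on the derivatives where they exist, and it allows
the kinks that occur when the active set of the QP changes. -/
structure IsBounded (A : Uncertainty P K) : Prop where
  xi_mem : ∀ t, 0 ≤ t → X.xi K t ∈ A.Om
  d_le : ∀ t, 0 ≤ t → ‖X.d A t‖ ≤ A.om0
  dCBF_le : ∀ t, 0 ≤ t → ‖X.dCBF A t‖ ≤ A.omb0
  d_rate : LipschitzOnWith A.om1.toNNReal (X.d A) (Ici 0)
  dCBF_rate : LipschitzOnWith K.omb1.toNNReal (X.dCBF A) (Ici 0)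

variable {P K} in
/-- Closed-loop solutions under all the assumptions: the observer of the barrier constraints starts
with zero estimation error, the wrench stays admissible, and the penalty weight exceeds the optimal
multiplier of the hard-constrained problem. -/
structure IsRun (A : Uncertainty P K) (zb Fb : ℝ) : Prop where
  closedLoop : X.IsClosedLoop P K
  scenario : X.IsScenario zb Fb
  bounded : X.IsBounded A
  observer_init : X.dhato K 0 = X.dCBF A 0
  wrench_mem : ∀ t, 0 < t → X.Fh t ∈ X.admissible P K t
  penalty : ∀ t, 0 < t → (X.qp P K (X.Fh t) t).PenaltyExceedsMultiplier

/-- Impedance tracking error and its derivative. -/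
def trackErr (t : ℝ) : Vec 6 := X.zimp t - P.hz (X.q t)
def trackErrd (t : ℝ) : Vec 6 := X.zimpd t - act (P.J (X.q t)) (X.qd t)

end Signals

/-- Uniform ultimate boundedness of an error signal over a family of motions: one ultimate bound,
reached after a time that depends only on the size of the initial data. -/
def UniformlyUltimatelyBounded {ι E : Type} [NormedAddCommGroup E] (fam : ι → Prop)
    (init : ι → ℝ) (err : ι → ℝ → E) : Prop :=
  ∃ b : ℝ, 0 < b ∧ ∀ a : ℝ, 0 < a → ∃ T : ℝ, 0 ≤ T ∧
    ∀ X, fam X → init X ≤ a → ∀ t, T ≤ t → ‖err X t‖ ≤ b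

end SafeImpedance

end

open SafeImpedance

noncomputable section

namespace SafeImpedance

/-! ### Linear differential inequalities -/

/-! The three claims rest on separate mechanisms.

Torque: the soft programme is an exact ℓ¹ penalty for the hard one. Pairing the KKT stationarity
condition with a displacement bounds the gain in the quadratic cost by the multipliers times the
slack. A larger `rho` outweighs that gain, and the term `eps` then forces the slack to vanish
(`IsSoftSolution.slack_eq_zero`). This covers positive times; continuity of the torque adds time
zero.

Safety: the plant reduces exactly to acceleration = command + sliding term + `dCBF`
(`IsClosedLoop.qdd_eq`). The safety observer is thus a first-order filter driven by `dCBF`; starting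
on that signal, it lags by at most `omb1 / alphaO` (`abs_sub_le_of_filter`). The margin dominates
this lag (`Controller.div_le_margin`), so the true acceleration obeys the undisturbed barrier
inequalities, and linear comparison gives invariance. For position limits the barrier is nonsmooth
in the velocity; `position_barrier_nonneg` replaces it by two smooth comparisons.

Impedance error: write `zimp - z = (zdes - z) - (zdes - zimp)`. The first difference is bounded
because `zdes` is bounded and the state stays in the compact `Om`. The second is a
mass-spring-damper under a bounded force, treated with a strict Lyapunov function
(`exists_lyapunov`) that yields a uniform entry time. -/

/-- Integrating factor: the derivative of the product is `exp (c t) (φ' + c φ) ≥ 0`. The rate `c`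
may have either sign. -/
theorem exp_mul_monotoneOn_of_deriv_ge {φ φ' : ℝ → ℝ} {c T : ℝ}
    (hφ : ∀ t ∈ Icc 0 T, HasDerivWithinAt φ (φ' t) (Ici 0) t)
    (h : ∀ t ∈ Icc 0 T, -c * φ t ≤ φ' t) :
    MonotoneOn (fun t => Real.exp (c * t) * φ t) (Icc 0 T) := by
  have hd : ∀ t ∈ Icc 0 T, HasDerivWithinAt (fun t => Real.exp (c * t) * φ t)
      (Real.exp (c * t) * c * φ t + Real.exp (c * t) * φ' t) (Icc 0 T) t := by
    intro t ht
    have h1 : HasDerivAt (fun t => Real.exp (c * t)) (Real.exp (c * t) * c) t := by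
      simpa using ((hasDerivAt_id t).const_mul c).exp
    exact h1.hasDerivWithinAt.mul ((hφ t ht).mono Icc_subset_Ici_self)
  refine monotoneOn_of_hasDerivWithinAt_nonneg (convex_Icc 0 T)
    (fun t ht => (hd t ht).continuousWithinAt)
    (fun t ht => (hd t (interior_subset ht)).mono interior_subset) fun t ht => ?_
  have := h t (interior_subset ht)
  have he := Real.exp_pos (c * t)
  nlinarith

theorem nonneg_of_deriv_ge {φ φ' : ℝ → ℝ} {c T : ℝ} (hT : 0 ≤ T)
    (hφ : ∀ t ∈ Icc 0 T, HasDerivWithinAt φ (φ' t) (Ici 0) t)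
    (h : ∀ t ∈ Icc 0 T, -c * φ t ≤ φ' t) (h0 : 0 ≤ φ 0) : 0 ≤ φ T := by
  have := exp_mul_monotoneOn_of_deriv_ge hφ h (left_mem_Icc.2 hT) (right_mem_Icc.2 hT) hT
  simp only [mul_zero, Real.exp_zero, one_mul] at this
  exact nonneg_of_mul_nonneg_right (h0.trans this) (Real.exp_pos _)

theorem le_exp_mul_of_deriv_le {φ φ' : ℝ → ℝ} {c T : ℝ} (hT : 0 ≤ T)
    (hφ : ∀ t ∈ Icc 0 T, HasDerivWithinAt φ (φ' t) (Ici 0) t)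
    (h : ∀ t ∈ Icc 0 T, φ' t ≤ -c * φ t) : φ T ≤ Real.exp (-(c * T)) * φ 0 := by
  have := exp_mul_monotoneOn_of_deriv_ge (φ := fun t => -φ t) (c := c)
    (fun t ht => (hφ t ht).neg) (fun t ht => by linarith [h t ht])
    (left_mem_Icc.2 hT) (right_mem_Icc.2 hT) hT
  simp only [mul_zero, Real.exp_zero, one_mul] at this
  rw [Real.exp_neg, inv_mul_eq_div, le_div_iff₀ (Real.exp_pos _)]
  linarith

/-- A first-order filter follows a Lipschitz signal with lag at most `w / α`, if it starts on it. -/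
theorem abs_sub_le_of_filter {y d : ℝ → ℝ} {α w T : ℝ} (hα : 0 < α) (hw : 0 ≤ w) (hT : 0 ≤ T)
    (hy : ∀ t ∈ Icc 0 T, HasDerivWithinAt y (α * (d t - y t)) (Ici 0) t)
    (hd : ∀ s ∈ Icc 0 T, ∀ t ∈ Icc 0 T, |d s - d t| ≤ w * |s - t|) (h0 : y 0 = d 0) :
    |d T - y T| ≤ w / α := by
  have key : ∀ (y d : ℝ → ℝ),
      (∀ t ∈ Icc 0 T, HasDerivWithinAt y (α * (d t - y t)) (Ici 0) t) →
      (∀ s ∈ Icc 0 T, ∀ t ∈ Icc 0 T, |d s - d t| ≤ w * |s - t|) → y 0 = d 0 →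
      d T - y T ≤ w / α := by
    intro y d hy hd h0
    -- The Lipschitz bound puts `d` above a ramp of slope `w` that meets it at the final time.
    have hdT : ∀ s ∈ Icc 0 T, d T - w * (T - s) ≤ d s := by
      intro s hs
      have := (abs_le.1 (hd s hs T (right_mem_Icc.2 hT))).1
      rw [abs_sub_comm, abs_of_nonneg (sub_nonneg.2 hs.2)] at this
      linarith
    -- The subtracted function is the steady filter response to that ramp, the ramp delayed by `w /
    -- α`; comparison keeps `y` above it.
    have := nonneg_of_deriv_ge (φ := fun s => y s - (d T - w * (T - s) - w / α)) (c := α)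
      (φ' := fun s => α * (d s - y s) - w) hT ?_ ?_ ?_
    · simp only [sub_self, mul_zero] at this
      linarith
    · intro t ht
      refine (hy t ht).sub ?_
      have : HasDerivAt (fun s => d T - w * (T - s) - w / α) (-(w * (-1))) t :=
        ((((hasDerivAt_id t).const_sub T).const_mul w).const_sub (d T)).sub_const _
      simpa using this.hasDerivWithinAt
    · intro t ht
      have h1 := hdT t ht
      have h2 : α * (w / α) = w := by field_simp
      have := mul_le_mul_of_nonneg_left h1 hα.le
      nlinarith
    · have h1 := hdT 0 (left_mem_Icc.2 hT)
      have : 0 ≤ w / α := by positivity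
      simp only [h0]
      linarith
  rw [abs_le]
  refine ⟨?_, key y d hy hd h0⟩
  -- The filter equation is odd, so changing both signs gives the other bound.
  have := key (fun t => -y t) (fun t => -d t) (fun t ht => ?_) (fun s hs t ht => ?_) (by simp [h0])
  · linarith
  · exact (hy t ht).neg.congr_deriv (by ring)
  · rw [← neg_sub_neg, neg_neg, neg_neg, abs_sub_comm]
    simpa [abs_sub_comm] using hd s hs t ht

/-! ### One joint with position and velocity limits -/

namespace Controller

theorem R1_nonneg (s : ℝ) : 0 ≤ R1 s := le_max_left _ _

theorem le_R1 (s : ℝ) : s ≤ R1 s := le_max_right _ _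

theorem R1_neg (s : ℝ) : R1 (-s) = R2 s := rfl

/-- Only the kink at zero matters: there the power is `O(|h| ^ l)`, which is `o(h)` since `l ≥ 2`.
-/
theorem hasDerivAt_R1_pow {l : ℕ} (hl : 2 ≤ l) (s : ℝ) :
    HasDerivAt (fun s => R1 s ^ l) (l * R1 s ^ (l - 1)) s := by
  rcases lt_trichotomy s 0 with hs | rfl | hs
  · have h1 : (fun s => R1 s ^ l) =ᶠ[nhds s] fun _ => 0 := by
      filter_upwards [eventually_lt_nhds hs] with x hx
      rw [R1, max_eq_left hx.le, zero_pow (by omega)]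
    rw [show R1 s = 0 from max_eq_left hs.le, zero_pow (by omega), mul_zero]
    exact (hasDerivAt_const s (0 : ℝ)).congr_of_eventuallyEq h1
  · have h0 : R1 0 = 0 := by simp [R1]
    rw [h0, zero_pow (by omega), mul_zero, hasDerivAt_iff_isLittleO_nhds_zero]
    simp only [zero_add, h0, zero_pow (show l ≠ 0 by omega), sub_zero, smul_zero]
    refine Asymptotics.IsBigO.trans_isLittleO (g := fun h : ℝ => h ^ l)
      (Asymptotics.IsBigO.of_bound 1 (Filter.Eventually.of_forall fun h => ?_))
      (Asymptotics.isLittleO_pow_id (by omega))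
    rw [one_mul, norm_pow, norm_pow, Real.norm_eq_abs, Real.norm_eq_abs, abs_of_nonneg (R1_nonneg h)]
    exact pow_le_pow_left₀ (R1_nonneg h) (max_le (abs_nonneg h) (le_abs_self h)) l
  · have h1 : (fun s => R1 s ^ l) =ᶠ[nhds s] fun s => s ^ l := by
      filter_upwards [eventually_gt_nhds hs] with x hx
      rw [R1, max_eq_right (le_of_lt hx)]
    rw [show R1 s = s from max_eq_right hs.le]
    exact (hasDerivAt_pow l s).congr_of_eventuallyEq h1

/-- Bernoulli's inequality at `R1 s`. It turns the nonlinear velocity bound near the position limit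
into a linear one. -/
theorem one_sub_R1_pow_le (l : ℕ) (s : ℝ) : 1 - R1 s ^ l ≤ l * (1 - s) := by
  have h := one_add_mul_sub_le_pow (by linarith [R1_nonneg s] : -1 ≤ R1 s) l
  have := mul_le_mul_of_nonneg_left (le_R1 s) (Nat.cast_nonneg (α := ℝ) l)
  linarith

/-- Forward invariance of `1 - R₁(q / q_max)ˡ - R₁(v / v_max) ≥ 0` under the barrier inequality. -/
theorem position_barrier_nonneg {q v a : ℝ → ℝ} {qm vm γ T : ℝ} {l : ℕ} (hl : 2 ≤ l)
    (hqm : 0 < qm) (hvm : 0 < vm) (hγ : 0 < γ) (hT : 0 ≤ T)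
    (hq : ∀ t, 0 ≤ t → HasDerivWithinAt q (v t) (Ici 0) t)
    (hv : ∀ t, 0 ≤ t → HasDerivWithinAt v (a t) (Ici 0) t)
    (ha : ∀ t, 0 ≤ t → a t ≤ vm * (-(l : ℝ) * (v t / qm) * R1 (q t / qm) ^ (l - 1)
      + γ * (1 - R1 (q t / qm) ^ l - R1 (v t / vm))))
    (h0 : 0 ≤ 1 - R1 (q 0 / qm) ^ l - R1 (v 0 / vm)) :
    0 ≤ 1 - R1 (q T / qm) ^ l - R1 (v T / vm) := by
  -- Dropping `R1` on the velocity makes the function differentiable; since `v / vm ≤ R1 (v / vm)`,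
  -- the barrier inequality survives.
  have hg : ∀ t, 0 ≤ t → 0 ≤ 1 - R1 (q t / qm) ^ l - v t / vm := by
    intro t ht
    refine nonneg_of_deriv_ge (φ := fun t => 1 - R1 (q t / qm) ^ l - v t / vm) (c := γ)
      (φ' := fun t => -(l * R1 (q t / qm) ^ (l - 1) * (v t / qm)) - a t / vm) ht
      (fun s hs => ?_) (fun s hs => ?_) ?_
    · have h1 := (hasDerivAt_R1_pow hl (q s / qm)).comp_hasDerivWithinAt s
        ((hq s hs.1).div_const qm)
      exact (h1.const_sub 1).sub ((hv s hs.1).div_const vm)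
    · have h1 : a s / vm ≤ -(l : ℝ) * (v s / qm) * R1 (q s / qm) ^ (l - 1)
          + γ * (1 - R1 (q s / qm) ^ l - R1 (v s / vm)) := by
        rw [div_le_iff₀' hvm]; exact ha s hs.1
      have h2 := mul_le_mul_of_nonneg_left (le_R1 (v s / vm)) hγ.le
      linarith
    · linarith [le_R1 (v 0 / vm)]
  -- `hg` alone does not bound the position when the velocity is negative. With Bernoulli it gives
  -- `v / vm ≤ l (1 - q / qm)`, so the distance to the limit decays at most exponentially.
  have hp : 0 ≤ 1 - q T / qm := by
    refine nonneg_of_deriv_ge (φ := fun t => 1 - q t / qm) (c := vm / qm * l)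
      (φ' := fun t => -(v t / qm)) hT (fun s hs => ((hq s hs.1).div_const qm).const_sub 1)
      (fun s hs => ?_) ?_
    · have h1 := hg s hs.1
      have h2 := one_sub_R1_pow_le l (q s / qm)
      have h3 : v s / qm = vm / qm * (v s / vm) := by field_simp
      have h4 := mul_le_mul_of_nonneg_left (show v s / vm ≤ l * (1 - q s / qm) by linarith)
        (show 0 ≤ vm / qm by positivity)
      rw [h3]; linarith
    · have h1 : R1 (q 0 / qm) ^ l ≤ 1 := by linarith [R1_nonneg (v 0 / vm)]
      have h2 := (pow_le_one_iff_of_nonneg (R1_nonneg _) (by omega)).1 h1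
      linarith [le_R1 (q 0 / qm)]
  have h1 : R1 (q T / qm) ^ l ≤ 1 :=
    pow_le_one₀ (R1_nonneg _) (max_le zero_le_one (by linarith))
  have h2 : R1 (v T / vm) ≤ 1 - R1 (q T / qm) ^ l :=
    max_le (by linarith) (by linarith [hg T hT])
  linarith

end Controller

/-! ### Robust margin against observer lag -/

theorem div_le_robust_margin {α ν γ β w : ℝ} (hν : 0 < ν) (hγ : 0 < γ) (hβ : 0 < β)
    (h : γ < 2 * α - ν) : w / α ≤ w ^ 2 / (2 * ν * β) + β / (4 * α - 2 * (ν + γ)) := by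
  have hα : 0 < α := by linarith
  have hk : 0 < 2 * α - ν - γ := by linarith
  have h2 : (4 * α - 2 * (ν + γ)) = 2 * (2 * α - ν - γ) := by ring
  rw [h2]
  set k := 2 * α - ν - γ with hkdef
  have hνk : ν + k ≤ 2 * α := by rw [hkdef]; linarith
  have h3 : 2 * (w / α) ≤ 2 * (w ^ 2 / (2 * ν * β) + β / (2 * k)) := by
    have e1 : 2 * (w ^ 2 / (2 * ν * β) + β / (2 * k)) - 2 * (w / α)
        = (w ^ 2 * k * α + β ^ 2 * ν * α - 2 * w * β * ν * k) / (ν * β * k * α) := by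
      field_simp
    -- Replacing `2 α` by the smaller `ν + k` in twice this expression leaves `(w k - β ν)² + ν k (w
    -- - β)²`.
    have : 0 ≤ w ^ 2 * k * α + β ^ 2 * ν * α - 2 * w * β * ν * k := by
      have : 0 ≤ (w ^ 2 * k + β ^ 2 * ν) * (2 * α - (ν + k)) :=
        mul_nonneg (by positivity) (by linarith)
      nlinarith [sq_nonneg (w * k - β * ν),
        mul_nonneg (mul_nonneg hν.le hk.le) (sq_nonneg (w - β))]
    have : 0 ≤ 2 * (w ^ 2 / (2 * ν * β) + β / (2 * k)) - 2 * (w / α) := by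
      rw [e1]; positivity
    linarith
  linarith

/-! ### Matrices acting on Euclidean vectors -/

section act

variable {ι κ : Type} [Fintype κ]

theorem act_add (A : Matrix ι κ ℝ) (x y : EuclideanSpace ℝ κ) :
    act A (x + y) = act A x + act A y := by
  ext i; simp [act, Matrix.mulVec_add]

theorem act_sub (A : Matrix ι κ ℝ) (x y : EuclideanSpace ℝ κ) :
    act A (x - y) = act A x - act A y := by
  ext i; simp [act, Matrix.mulVec_sub]

theorem act_smul (A : Matrix ι κ ℝ) (c : ℝ) (x : EuclideanSpace ℝ κ) :
    act A (c • x) = c • act A x := by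
  ext i; simp [act, Matrix.mulVec_smul]

theorem sub_act (A B : Matrix ι κ ℝ) (x : EuclideanSpace ℝ κ) :
    act (A - B) x = act A x - act B x := by
  ext i; simp [act, Matrix.sub_mulVec]

theorem continuousOn_act {X : Type} [TopologicalSpace X] {s : Set X} {A : X → Matrix ι κ ℝ}
    {v : X → EuclideanSpace ℝ κ} (hA : ContinuousOn A s) (hv : ContinuousOn v s) :
    ContinuousOn (fun t => act (A t) (v t)) s := by
  refine (PiLp.continuous_toLp 2 _).comp_continuousOn ?_
  have : Continuous fun p : Matrix ι κ ℝ × EuclideanSpace ℝ κ => p.1 *ᵥ p.2.ofLp :=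
    continuous_fst.matrix_mulVec ((PiLp.continuous_ofLp 2 _).comp continuous_snd)
  exact this.comp_continuousOn (hA.prodMk hv)

variable [Fintype ι]

theorem act_inv_act [DecidableEq ι] {A : Matrix ι ι ℝ} (hA : A.PosDef) (x : EuclideanSpace ℝ ι) :
    act A⁻¹ (act A x) = x := by
  have := hA.det_pos.ne'
  ext i
  simp [act, Matrix.mulVec_mulVec, Matrix.nonsing_inv_mul A (isUnit_iff_ne_zero.2 this)]

theorem act_act_inv [DecidableEq ι] {A : Matrix ι ι ℝ} (hA : A.PosDef) (x : EuclideanSpace ℝ ι) :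
    act A (act A⁻¹ x) = x := by
  have := hA.det_pos.ne'
  ext i
  simp [act, Matrix.mulVec_mulVec, Matrix.mul_nonsing_inv A (isUnit_iff_ne_zero.2 this)]

theorem inner_act (A : Matrix ι κ ℝ) (x : EuclideanSpace ℝ ι) (y : EuclideanSpace ℝ κ) :
    inner ℝ x (act A y) = inner ℝ (act Aᵀ x) y := by
  simp only [EuclideanSpace.inner_eq_star_dotProduct, act, star_trivial]
  rw [Matrix.mulVec_transpose, dotProduct_comm, Matrix.dotProduct_mulVec, dotProduct_comm]

/-- The matrix-vector product as a continuous linear map. -/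
def actCLM (A : Matrix ι κ ℝ) : EuclideanSpace ℝ κ →L[ℝ] EuclideanSpace ℝ ι :=
  LinearMap.toContinuousLinearMap
    { toFun := act A
      map_add' := act_add A
      map_smul' := act_smul A }

theorem actCLM_apply (A : Matrix ι κ ℝ) (x : EuclideanSpace ℝ κ) : actCLM A x = act A x := rfl

/-- The constant is the minimum of the quadratic form on the compact unit sphere; homogeneity does
the rest. -/
theorem exists_forall_mul_sq_le_inner_act [Nonempty ι] {A : Matrix ι ι ℝ} (hA : A.PosDef) :
    ∃ m, 0 < m ∧ ∀ x : EuclideanSpace ℝ ι, m * ‖x‖ ^ 2 ≤ inner ℝ x (act A x) := by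
  have hpos : ∀ x : EuclideanSpace ℝ ι, x ≠ 0 → 0 < inner ℝ x (act A x) := by
    intro x hx
    have := hA.dotProduct_mulVec_pos (x := x.ofLp) (by simpa using hx)
    simpa [EuclideanSpace.inner_eq_star_dotProduct, act, dotProduct_comm] using this
  obtain ⟨x₀, hx₀, hmin⟩ := (isCompact_sphere (0 : EuclideanSpace ℝ ι) 1).exists_isMinOn
    (NormedSpace.sphere_nonempty.2 zero_le_one)
    (f := fun x => inner ℝ x (actCLM A x)) (by fun_prop)
  have hn₀ : ‖x₀‖ = 1 := by simpa using hx₀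
  refine ⟨inner ℝ x₀ (act A x₀), hpos x₀ (by rintro rfl; simp at hn₀), fun x => ?_⟩
  rcases eq_or_ne x 0 with rfl | hx
  · simp
  have hnx : 0 < ‖x‖ := norm_pos_iff.2 hx
  have := hmin (show ‖x‖⁻¹ • x ∈ Metric.sphere (0 : EuclideanSpace ℝ ι) 1 by
    simp [norm_smul, hnx.ne'])
  simp only [mem_ofPred_eq, inner_smul_left, actCLM_apply, act_smul,
    inner_smul_right, RCLike.conj_to_real] at this
  calc _ ≤ (‖x‖⁻¹ * (‖x‖⁻¹ * inner ℝ x (act A x))) * ‖x‖ ^ 2 := by gcongr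
    _ = _ := by field_simp

theorem norm_act_le (A : Matrix ι κ ℝ) (x : EuclideanSpace ℝ κ) :
    ‖act A x‖ ≤ ‖actCLM A‖ * ‖x‖ := (actCLM A).le_opNorm x

theorem hasDerivWithinAt_act {f : ℝ → EuclideanSpace ℝ κ} {f' : EuclideanSpace ℝ κ} {s : Set ℝ}
    {t : ℝ} (A : Matrix ι κ ℝ) (hf : HasDerivWithinAt f f' s t) :
    HasDerivWithinAt (fun t => act A (f t)) (act A f') s t :=
  (actCLM A).hasFDerivAt.comp_hasDerivWithinAt t hf

theorem hasDerivWithinAt_apply {f : ℝ → EuclideanSpace ℝ κ} {f' : EuclideanSpace ℝ κ}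
    {s : Set ℝ} {t : ℝ} (hf : HasDerivWithinAt f f' s t) (i : κ) :
    HasDerivWithinAt (fun t => f t i) (f' i) s t :=
  (EuclideanSpace.proj (𝕜 := ℝ) i).hasFDerivAt.comp_hasDerivWithinAt t hf

end act

/-! ### Exact penalty -/

namespace QPData

variable {n : ℕ} (D : QPData n)

theorem isCompact_hardFeasible : IsCompact D.hardFeasible := by
  have hc : IsClosed D.hardFeasible := by
    have ht : Continuous D.torque :=
      ((actCLM D.H).continuous.sub continuous_const : Continuous fun a => actCLM D.H a - D.base)
    have happ : ∀ i, Continuous fun v : Vec n => v i := fun i =>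
      (EuclideanSpace.proj (𝕜 := ℝ) i).continuous
    simp only [hardFeasible, InBox, ofPred_and, ofPred_forall]
    exact (isClosed_iInter fun i => (isClosed_le continuous_const (happ i)).inter
      (isClosed_le (happ i) continuous_const)).inter
      (isClosed_iInter fun i => (isClosed_le continuous_const ((happ i).comp ht)).inter
      (isClosed_le ((happ i).comp ht) continuous_const))
  have hK : IsCompact (WithLp.toLp 2 '' Icc D.lo.ofLp D.hi.ofLp) :=
    isCompact_Icc.image (PiLp.continuous_toLp 2 _)
  refine hK.of_isClosed_subset hc fun a ha => ⟨a.ofLp, ⟨fun i => (ha.1 i).1, fun i => (ha.1 i).2⟩, rfl⟩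

theorem exists_isHardSolution (h : D.hardFeasible.Nonempty) : ∃ a, D.IsHardSolution a :=
  D.isCompact_hardFeasible.exists_isMinOn h (by fun_prop)

variable {D}

/-- The multiplier term of one torque constraint is bounded below by the weighted slack. -/
theorem multiplier_term_ge {τ τ₀ tlo thi llo lhi s : ℝ} (hllo : 0 ≤ llo) (hlhi : 0 ≤ lhi)
    (hlo : tlo - s ≤ τ) (hhi : τ ≤ thi + s) (hslo : llo * (τ₀ - tlo) = 0)
    (hshi : lhi * (thi - τ₀) = 0) :
    -(max llo lhi * s) ≤ -((lhi - llo) * (τ - τ₀)) := by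
  rcases mul_eq_zero.1 hslo with h1 | h1
  · subst h1
    rw [max_eq_right hlhi]
    nlinarith
  rcases mul_eq_zero.1 hshi with h2 | h2
  · subst h2
    rw [max_eq_left hllo]
    nlinarith
  -- Both torque bounds are active, so the interval is a point and both multipliers may be positive.
  -- Then `|τ - τ₀| ≤ s` and `|lhi - llo| ≤ max llo lhi` suffice.
  have e1 : τ₀ = tlo := by linarith
  have e2 : thi = tlo := by linarith
  subst e1 e2
  rcases le_total llo lhi with h | h
  · rw [max_eq_right h]
    nlinarith
  · rw [max_eq_left h]
    nlinarith

/-- The first-order optimality condition at `a₀`, relaxed to soft-feasible points: by complementary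
slackness the box terms are nonnegative, and violating a torque bound gains at most its multiplier
times the slack. -/
theorem IsMultiplier.inner_ge {a₀ mlo mhi llo lhi : Vec n}
    (hm : D.IsMultiplier a₀ mlo mhi llo lhi)
    {a s : Vec n} (has : (a, s) ∈ D.softFeasible) :
    -∑ i, max (llo i) (lhi i) * s i ≤ inner ℝ (a₀ - D.nom) (a - a₀) := by
  obtain ⟨hbox, htor, hs⟩ := has
  have e : a₀ - D.nom = mlo - mhi - act D.Hᵀ (lhi - llo) := by
    have := hm.stationary
    rw [← sub_eq_zero, ← this]; abel
  have e2 : act D.H (a - a₀) = D.torque a - D.torque a₀ := by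
    simp [torque, act_sub]
  rw [e, inner_sub_left, ← inner_act, e2]
  simp only [EuclideanSpace.inner_eq_star_dotProduct, dotProduct, star_trivial]
  rw [← Finset.sum_sub_distrib, ← Finset.sum_neg_distrib]
  refine Finset.sum_le_sum fun i _ => ?_
  have h1 := multiplier_term_ge (hm.nonneg i).2.2.1 (hm.nonneg i).2.2.2 (htor i).1
    (htor i).2 (hm.slack_tlo i) (hm.slack_thi i)
  have h2 := mul_nonneg (hm.nonneg i).1 (sub_nonneg.2 (hbox i).1)
  have h3 := mul_nonneg (hm.nonneg i).2.1 (sub_nonneg.2 (hbox i).2)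
  have h4 := hm.slack_lo i
  have h5 := hm.slack_hi i
  simp only [PiLp.sub_apply]
  simp only at h2 h3
  nlinarith

/-- Expanding the cost around the hard optimum, `inner_ge` and the size of `rho` show that a soft
point costs at least the hard optimum plus `eps / 2 * ‖s‖ ^ 2`. -/
theorem IsSoftSolution.slack_eq_zero (hε : 0 < D.eps) (hne : D.hardFeasible.Nonempty)
    (hp : D.PenaltyExceedsMultiplier) {a s : Vec n} (h : D.IsSoftSolution a s) : s = 0 := by
  obtain ⟨a₀, ha₀⟩ := D.exists_isHardSolution hne
  obtain ⟨mlo, mhi, llo, lhi, hm, hρ⟩ := hp a₀ ha₀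
  have hfeas : (a₀, (0 : Vec n)) ∈ D.softFeasible :=
    ⟨ha₀.1.1, fun i => by simpa using ha₀.1.2 i, fun i => le_rfl⟩
  have hcost : D.softCost (a, s) ≤ D.softCost (a₀, 0) := h.2 hfeas
  have hin := hm.inner_ge h.1
  have hexp : ‖a - D.nom‖ ^ 2 =
      ‖a₀ - D.nom‖ ^ 2 + 2 * inner ℝ (a₀ - D.nom) (a - a₀) + ‖a - a₀‖ ^ 2 := by
    rw [← norm_add_sq_real]; congr 2; abel
  have hsum : ∑ i, max (llo i) (lhi i) * s i ≤ D.rho * ∑ i, s i := by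
    rw [Finset.mul_sum]
    exact Finset.sum_le_sum fun i _ =>
      mul_le_mul_of_nonneg_right (max_le (hρ i).1.le (hρ i).2.le) (h.1.2.2 i)
  simp only [softCost, PiLp.zero_apply, Finset.sum_const_zero, norm_zero] at hcost
  have : D.eps / 2 * ‖s‖ ^ 2 ≤ 0 := by nlinarith [sq_nonneg ‖a - a₀‖]
  have h2 : ‖s‖ ^ 2 ≤ 0 := nonpos_of_mul_nonpos_right this (by positivity)
  exact norm_eq_zero.1 (pow_eq_zero_iff two_ne_zero |>.1 (le_antisymm h2 (sq_nonneg _)))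

end QPData

/-! ### Torque limits -/

namespace Plant

variable {n : ℕ} (P : Plant n)

theorem continuous_J : Continuous P.J := by
  have h := P.hz_smooth.continuous_fderiv (by simp)
  refine continuous_matrix fun a j => ?_
  exact (EuclideanSpace.proj (𝕜 := ℝ) a).continuous.comp (h.clm_apply continuous_const)

end Plant

namespace Signals

open Controller

variable {n R m : ℕ} {X : Signals n R m} {P : Plant n} {K : Controller n R m}

/-- Solving the equation of motion for the torque avoids any regularity analysis of the programme's
minimiser. -/
theorem IsClosedLoop.continuousOn_u (h : X.IsClosedLoop P K) (hF : ContinuousOn X.Fh (Ici 0))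
    (hd : ContinuousOn X.taud (Ici 0)) : ContinuousOn (X.u P K) (Ici 0) := by
  have hq : ContinuousOn X.q (Ici 0) := fun t ht => (h.q_deriv t ht).continuousWithinAt
  have hqd : ContinuousOn X.qd (Ici 0) := fun t ht => (h.qd_deriv t ht).continuousWithinAt
  have e : EqOn (X.u P K) (fun t => act (P.M (X.q t)) (X.qdd t)
      + act (P.C (X.q t) (X.qd t)) (X.qd t) + P.G (X.q t) + X.taud t
      - act (P.J (X.q t))ᵀ (X.Fh t)) (Ici 0) := fun t ht =>
    eq_sub_of_add_eq (h.dynamics t ht).symm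
  refine ContinuousOn.congr ?_ e
  have hJ : ContinuousOn (fun t => (P.J (X.q t))ᵀ) (Ici 0) :=
    P.continuous_J.matrix_transpose.comp_continuousOn hq
  exact ((((continuousOn_act (P.M_cont.comp_continuousOn hq) h.qdd_cont).add
    (continuousOn_act (P.C_cont.comp_continuousOn (hq.prodMk hqd)) hqd)).add
    (P.G_cont.comp_continuousOn hq)).add hd).sub (continuousOn_act hJ hF)

variable {A : Uncertainty P K} {zb Fb : ℝ}

theorem IsRun.torque_mem (h : X.IsRun A zb Fb) {t : ℝ} (ht : 0 ≤ t) (i : Fin n) :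
    X.u P K t i ∈ Icc (K.tmin i) (K.tmax i) := by
  have hpos : ∀ t ∈ Ioi (0 : ℝ), X.u P K t i ∈ Icc (K.tmin i) (K.tmax i) := by
    intro t ht
    have hs := h.closedLoop.qp_solution t (le_of_lt ht)
    have h0 := hs.slack_eq_zero K.epsS_pos (h.wrench_mem t ht) (h.penalty t ht)
    have := hs.1.2.1 i
    simp only [h0, PiLp.zero_apply, sub_zero, add_zero] at this
    exact this
  obtain ⟨L, hL⟩ := h.scenario.taud_lip
  have hc := h.closedLoop.continuousOn_u h.scenario.Fh_cont hL.continuousOn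
  have hci : ContinuousWithinAt (fun t => X.u P K t i) (Ioi 0) t :=
    ((EuclideanSpace.proj (𝕜 := ℝ) i).continuous.comp_continuousOn hc t ht).mono Ioi_subset_Ici_self
  -- Admissibility and the penalty condition hold only for positive times; closedness of the
  -- interval extends the bound to time zero.
  exact isClosed_Icc.closure_subset
    (hci.mem_closure (by rw [closure_Ioi]; exact ht) hpos)

/-! ### Safety -/

/-- In closed loop, the joint acceleration is the command plus the disturbance `d_CBF`. -/
theorem IsClosedLoop.qdd_eq (h : X.IsClosedLoop P K) {t : ℝ} (ht : 0 ≤ t)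
    (hxi : X.xi K t ∈ A.Om) : X.qdd t = X.qcmd t + X.qs K t + X.dCBF A t := by
  have hM := P.M_posDef (X.q t)
  have hdec := A.decomp _ hxi
  have hf : A.fvec (X.xi K t) = K.structured P (X.xi K t) - A.g (X.xi K t) := by
    rw [hdec, add_sub_cancel_right]; rfl
  have hdyn := h.dynamics t ht
  have inj : Function.Injective (act (P.M (X.q t))) :=
    Function.LeftInverse.injective (act_inv_act hM)
  -- After multiplication by the inertia matrix the inverses in the structured uncertainty and in
  -- `delta` disappear, and the claim is the equation of motion rearranged.
  apply inj
  have e1 : act (P.M (X.q t)) (K.structured P (X.xi K t)) =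
      act (K.Mhat (X.q t) - P.M (X.q t)) (X.qs K t - X.dhatc K t)
      + act (K.Chat (X.q t) (X.qd t) - P.C (X.q t) (X.qd t)) (X.qd t)
      + (K.Ghat (X.q t) - P.G (X.q t)) := act_act_inv hM _
  have e2 : act (P.M (X.q t)) (X.delta P K t) = X.taud t
    - act (K.Mhat (X.q t) - P.M (X.q t)) (X.qcmd t - K.fhat (X.xi K t) (X.theta t)) :=
    act_act_inv hM _
  simp only [dCBF, deltaBar, hf, act_add, act_sub, e1, e2, sub_act]
  simp only [u, tauBase, act_sub] at hdyn
  rw [← sub_eq_zero] at hdyn ⊢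
  rw [← hdyn]
  abel

/-- Substituting `qdd_eq` cancels the command and sliding terms, so the observer output has
derivative `alphaO * (dCBF - dhato)`: a filter that starts on its input. -/
theorem IsRun.abs_observer_error_le (h : X.IsRun A zb Fb) {t : ℝ} (ht : 0 ≤ t) (i : Fin n) :
    |X.dCBF A t i - X.dhato K t i| ≤ K.omb1 / K.alphaO := by
  refine abs_sub_le_of_filter (y := fun t => X.dhato K t i) (d := fun t => X.dCBF A t i)
    K.alphaO_pos K.omb1_pos.le ht (fun s hs => ?_) (fun s hs t' ht' => ?_)
    (by simp only [h.observer_init])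
  · have h1 := (h.closedLoop.ello_law s hs.1).add
      ((h.closedLoop.qd_deriv s hs.1).const_smul K.alphaO)
    refine (hasDerivWithinAt_apply h1 i).congr_deriv ?_
    rw [h.closedLoop.qdd_eq hs.1 (h.bounded.xi_mem s hs.1)]
    simp only [PiLp.add_apply, PiLp.smul_apply, smul_eq_mul]
    ring
  · have h1 := h.bounded.dCBF_rate.dist_le_mul s hs.1 t' ht'.1
    rw [Real.coe_toNNReal _ K.omb1_pos.le, dist_eq_norm, Real.dist_eq] at h1
    exact (PiLp.norm_apply_le (X.dCBF A s - X.dCBF A t') i).trans h1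

end Signals

theorem Controller.div_le_margin {n R m : ℕ} (K : Controller n R m) (i : Fin n) :
    K.omb1 / K.alphaO ≤ K.margin i := by
  have hV : K.gamV < 2 * K.alphaO - K.nu := (le_max_left _ _).trans_lt K.gam_lt
  have hP : K.gamP < 2 * K.alphaO - K.nu := (le_max_right _ _).trans_lt K.gam_lt
  have hv := K.vmax_pos i
  by_cases hi : i ∈ K.Jp
  -- The position margin is the velocity one with `beta / vmax` in place of `beta`.
  · have := div_le_robust_margin (w := K.omb1) K.nu_pos K.gamP_pos (div_pos K.beta_pos hv) hP
    refine this.trans_eq ?_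
    simp only [margin, hi, if_true]
    have := K.nu_pos
    have := K.beta_pos
    congr 1
    field_simp
  · have := div_le_robust_margin (w := K.omb1) K.nu_pos K.gamV_pos K.beta_pos hV
    simpa only [margin, hi, if_false] using this

namespace Signals

open Controller

variable {n R m : ℕ} {X : Signals n R m} {P : Plant n} {K : Controller n R m}
  {A : Uncertainty P K} {zb Fb : ℝ}

/-- The acceleration satisfies the undisturbed barrier inequalities. -/
theorem IsRun.qdd_mem (h : X.IsRun A zb Fb) {t : ℝ} (ht : 0 ≤ t) (i : Fin n) :
    X.qdd t i ∈ Icc (K.alphaA (X.x t) i) (K.alphaB (X.x t) i) := by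
  have hbox := (h.closedLoop.qp_solution t ht).1.1 i
  have herr := abs_le.1 ((h.abs_observer_error_le ht i).trans (K.div_le_margin i))
  rw [h.closedLoop.qdd_eq ht (h.bounded.xi_mem t ht)]
  simp only [qp, PiLp.add_apply, PiLp.sub_apply, PiLp.neg_apply] at hbox
  simp only [PiLp.add_apply, mem_Icc]
  constructor <;> linarith

theorem IsRun.hv_nonneg (h : X.IsRun A zb Fb) {i : Fin n} (hi : i ∉ K.Jp)
    (h0 : 0 ≤ K.hv i (X.x 0)) {t : ℝ} (ht : 0 ≤ t) : 0 ≤ K.hv i (X.x t) := by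
  have hd : ∀ s ∈ Icc 0 t, HasDerivWithinAt (fun s => X.qd s i) (X.qdd s i) (Ici 0) s :=
    fun s hs => hasDerivWithinAt_apply (h.closedLoop.qd_deriv s hs.1) i
  refine le_min ?_ ?_
  · refine nonneg_of_deriv_ge (c := K.gamV) (φ := fun s => K.hv1 i (X.x s)) ht
      (fun s hs => (hd s hs).const_sub _) (fun s hs => ?_) (h0.trans (min_le_left _ _))
    have := (h.qdd_mem hs.1 i).2
    simp only [alphaB, hi, if_false] at this
    linarith
  · refine nonneg_of_deriv_ge (c := K.gamV) (φ := fun s => K.hv2 i (X.x s)) ht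
      (fun s hs => (hd s hs).const_add _) (fun s hs => ?_) (h0.trans (min_le_right _ _))
    have := (h.qdd_mem hs.1 i).1
    simpa only [alphaA, hi, if_false] using this

theorem IsRun.hp_nonneg (h : X.IsRun A zb Fb) {i : Fin n} (hi : i ∈ K.Jp)
    (h0 : 0 ≤ K.hp i (X.x 0)) {t : ℝ} (ht : 0 ≤ t) : 0 ≤ K.hp i (X.x t) := by
  have hq : ∀ s, 0 ≤ s → HasDerivWithinAt (fun s => X.q s i) (X.qd s i) (Ici 0) s :=
    fun s hs => hasDerivWithinAt_apply (h.closedLoop.q_deriv s hs) i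
  have hd : ∀ s, 0 ≤ s → HasDerivWithinAt (fun s => X.qd s i) (X.qdd s i) (Ici 0) s :=
    fun s hs => hasDerivWithinAt_apply (h.closedLoop.qd_deriv s hs) i
  refine le_min ?_ ?_
  · refine position_barrier_nonneg K.l_ge (K.qmax_pos i hi) (K.vmax_pos i) K.gamP_pos ht hq hd
      (fun s hs => ?_) (h0.trans (min_le_left _ _))
    have := (h.qdd_mem hs i).2
    simpa only [alphaB, hi, if_true, hp1, x] using this
  -- The lower limit is the upper one for the reflected joint `(-q, -v)`, which turns `R2` into
  -- `R1`.
  · have := position_barrier_nonneg K.l_ge (K.qmax_pos i hi) (K.vmax_pos i) K.gamP_pos ht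
      (fun s hs => (hq s hs).neg) (fun s hs => (hd s hs).neg) (fun s hs => ?_) ?_
    · simpa only [Pi.neg_apply, neg_div, R1_neg, hp2, x] using this
    · have := (h.qdd_mem hs i).1
      simp only [alphaA, hi, if_true, hp2] at this
      simp only [Pi.neg_apply, neg_div, R1_neg]
      simp only [x] at this
      linarith
    · simpa only [Pi.neg_apply, neg_div, R1_neg, hp2, x] using h0.trans (min_le_right _ _)

theorem IsRun.mem_Cstar (h : X.IsRun A zb Fb) (h0 : X.x 0 ∈ K.Cstar) {t : ℝ} (ht : 0 ≤ t) :
    X.x t ∈ K.Cstar :=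
  ⟨fun i hi => h.hv_nonneg hi (h0.1 i hi) ht, fun i hi => h.hp_nonneg hi (h0.2 i hi) ht⟩

end Signals

/-! ### Ultimate boundedness of the impedance error -/

/-- A strict Lyapunov function for the mass-spring-damper system, in the position `e` and the
velocity `v`. -/
theorem exists_lyapunov {k : ℕ} [NeZero k] {M B S : Matrix (Fin k) (Fin k) ℝ} (hM : M.PosDef)
    (hB : B.PosDef) (hS : S.PosDef) (F : ℝ) :
    ∃ ε c m L C : ℝ, 0 < c ∧ 0 < m ∧ 0 < L ∧ 0 ≤ C ∧ ∀ e v : Vec k,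
      let V := 1 / 2 * inner ℝ v (act M v) + 1 / 2 * inner ℝ e (act S e) + ε * inner ℝ e (act M v)
      m * ‖e‖ ^ 2 ≤ V ∧ V ≤ L * (‖e‖ ^ 2 + ‖v‖ ^ 2) ∧
      ∀ w f : Vec k, act M w + act B v + act S e = f → ‖f‖ ≤ F →
        inner ℝ v (act M w) + inner ℝ v (act S e)
          + ε * (inner ℝ v (act M v) + inner ℝ e (act M w)) ≤ -c * V + C := by
  obtain ⟨m₁, hm₁, hM₁⟩ := exists_forall_mul_sq_le_inner_act hM
  obtain ⟨m₂, hm₂, hB₁⟩ := exists_forall_mul_sq_le_inner_act hB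
  obtain ⟨m₃, hm₃, hS₁⟩ := exists_forall_mul_sq_le_inner_act hS
  obtain ⟨m, hm, hmm₁, hmm₂, hmm₃⟩ : ∃ m, 0 < m ∧ m ≤ m₁ ∧ m ≤ m₂ ∧ m ≤ m₃ :=
    ⟨min m₁ (min m₂ m₃), by positivity, min_le_left _ _,
      (min_le_right _ _).trans (min_le_left _ _), (min_le_right _ _).trans (min_le_right _ _)⟩
  -- Requiring `m ≤ L` lets `ε L ≤ m / 4` follow from `ε L² = m² / 4`.
  obtain ⟨L, hmL, hL₁, hL₂, hL₃⟩ : ∃ L, m ≤ L ∧ ‖actCLM M‖ ≤ L ∧ ‖actCLM B‖ ≤ L ∧ ‖actCLM S‖ ≤ L :=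
    ⟨max m (max ‖actCLM M‖ (max ‖actCLM B‖ ‖actCLM S‖)), by simp, by simp, by simp, by simp⟩
  have hL : 0 < L := hm.trans_le hmL
  have lower : ∀ {m' : ℝ} {Q : Matrix (Fin k) (Fin k) ℝ}, m ≤ m' →
      (∀ x, m' * ‖x‖ ^ 2 ≤ inner ℝ x (act Q x)) → ∀ x, m * ‖x‖ ^ 2 ≤ inner ℝ x (act Q x) :=
    fun h hQ x => (mul_le_mul_of_nonneg_right h (sq_nonneg _)).trans (hQ x)
  have upper : ∀ {Q : Matrix (Fin k) (Fin k) ℝ}, ‖actCLM Q‖ ≤ L → ∀ x y : Vec k,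
      |inner ℝ x (act Q y)| ≤ L * (‖x‖ * ‖y‖) := fun {Q} hQ x y =>
    calc _ ≤ ‖x‖ * ‖act Q y‖ := abs_real_inner_le_norm _ _
      _ ≤ ‖x‖ * (L * ‖y‖) := by gcongr; exact (norm_act_le Q y).trans (by gcongr)
      _ = _ := by ring
  -- `ε` makes the cross terms small against the damping and the stiffness.
  set ε := m ^ 2 / (4 * L ^ 2) with hε
  have hε0 : 0 < ε := by positivity
  have hεL2 : ε * L ^ 2 = m ^ 2 / 4 := by rw [hε]; field_simp
  have hεL : ε * L ≤ m / 4 := by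
    have : ε * L * L ≤ m / 4 * L := by nlinarith
    exact le_of_mul_le_mul_right this hL
  -- What remains of the dissipation: stiffness leaves `ε m / 2` on `‖e‖²`, and damping leaves `3 m
  -- / 8`, hence at least `m / 4`, on `‖v‖²`.
  set c₀ := min (m / 4) (ε * m / 2) with hc₀
  have hc₀0 : 0 < c₀ := by positivity
  refine ⟨ε, c₀ / (2 * L), m / 4, 2 * L, F ^ 2 * (2 + ε) / m, by positivity, by positivity,
    by positivity, by positivity, fun e v => ?_⟩
  intro V
  have hcross := abs_le.1 (upper hL₁ e v)
  set x := ‖e‖ with hx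
  set y := ‖v‖ with hy
  have hx0 : 0 ≤ x := norm_nonneg e
  have hy0 : 0 ≤ y := norm_nonneg v
  have hεxy : ε * L * (x * y) ≤ m / 4 * (x * y) := by gcongr
  have hMv := lower hmm₁ hM₁ v
  have hSe := lower hmm₃ hS₁ e
  have hMv' := (le_abs_self _).trans (upper hL₁ v v)
  have hSe' := (le_abs_self _).trans (upper hL₃ e e)
  rw [← hx] at hSe hSe'
  rw [← hy] at hMv hMv'
  have hVup : V ≤ 2 * L * (x ^ 2 + y ^ 2) := by
    have := mul_le_mul_of_nonneg_left hcross.2 hε0.le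
    have : m / 4 * (x * y) ≤ L * (x * y) := by gcongr; linarith
    simp only [V]
    nlinarith [sq_nonneg (x - y), sq_nonneg (x + y)]
  refine ⟨?_, hVup, fun w f hdyn hf => ?_⟩
  · have := mul_le_mul_of_nonneg_left hcross.1 hε0.le
    simp only [V]
    nlinarith [sq_nonneg (x - y)]
  · have hw : act M w = f - act B v - act S e := by rw [← hdyn]; abel
    have hBv := lower hmm₂ hB₁ v
    have hBe := (neg_le_of_abs_le (upper hL₂ e v))
    have hF0 : 0 ≤ F := (norm_nonneg f).trans hf
    have hvf : inner ℝ v f ≤ y * F := (real_inner_le_norm v f).trans (by gcongr)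
    have hef : inner ℝ e f ≤ x * F := (real_inner_le_norm e f).trans (by gcongr)
    rw [← hx, ← hy] at hBe
    rw [← hy] at hBv
    rw [hw]
    simp only [inner_sub_right]
    have y1 : y * F ≤ m / 8 * y ^ 2 + 2 * F ^ 2 / m := by
      have : m / 8 * y ^ 2 + 2 * F ^ 2 / m - y * F = (m * y - 4 * F) ^ 2 / (8 * m) := by
        field_simp; ring
      have : 0 ≤ (m * y - 4 * F) ^ 2 / (8 * m) := by positivity
      linarith
    have y2 : x * F ≤ m / 4 * x ^ 2 + F ^ 2 / m := by
      have : m / 4 * x ^ 2 + F ^ 2 / m - x * F = (m * x - 2 * F) ^ 2 / (4 * m) := by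
        field_simp; ring
      have : 0 ≤ (m * x - 2 * F) ^ 2 / (4 * m) := by positivity
      linarith
    have y3 : L * (x * y) ≤ m / 4 * x ^ 2 + L ^ 2 / m * y ^ 2 := by
      have : m / 4 * x ^ 2 + L ^ 2 / m * y ^ 2 - L * (x * y) = (m * x - 2 * L * y) ^ 2 / (4 * m) := by
        field_simp; ring
      have : 0 ≤ (m * x - 2 * L * y) ^ 2 / (4 * m) := by positivity
      linarith
    have y4 : ε * (L ^ 2 / m) = m / 4 := by
      rw [← mul_div_assoc, hεL2]; field_simp
    have y5 : ε * inner ℝ v (act M v) ≤ m / 4 * y ^ 2 :=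
      calc _ ≤ ε * (L * (y * y)) := by gcongr
        _ = ε * L * y ^ 2 := by ring
        _ ≤ _ := by gcongr
    have y6 : ε * inner ℝ e f ≤ ε * (m / 4 * x ^ 2 + F ^ 2 / m) := by gcongr; linarith
    have y7 : ε * (-inner ℝ e (act B v)) ≤ ε * (m / 4 * x ^ 2 + L ^ 2 / m * y ^ 2) := by
      gcongr; linarith
    have y8 : ε * (m * x ^ 2) ≤ ε * inner ℝ e (act S e) := by gcongr
    have y9 : c₀ * (x ^ 2 + y ^ 2) ≤ ε * m / 2 * x ^ 2 + m / 4 * y ^ 2 := by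
      have h1 := mul_le_mul_of_nonneg_right (min_le_left (m / 4) (ε * m / 2)) (sq_nonneg y)
      have h2 := mul_le_mul_of_nonneg_right (min_le_right (m / 4) (ε * m / 2)) (sq_nonneg x)
      rw [← hc₀] at h1 h2
      linarith
    have y10 : c₀ / (2 * L) * V ≤ c₀ * (x ^ 2 + y ^ 2) := by
      calc _ ≤ c₀ / (2 * L) * (2 * L * (x ^ 2 + y ^ 2)) := by gcongr
        _ = _ := by field_simp
    have y11 : ε * (m / 4 * x ^ 2 + L ^ 2 / m * y ^ 2) = ε * m / 4 * x ^ 2 + m / 4 * y ^ 2 := by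
      rw [mul_add, ← mul_assoc ε (L ^ 2 / m), y4]; ring
    have y12 : F ^ 2 * (2 + ε) / m = 2 * F ^ 2 / m + ε * (F ^ 2 / m) := by ring
    have y13 : 0 ≤ m * y ^ 2 := by positivity
    rw [y12]
    linarith

/-- Solutions of a mass-spring-damper system under a bounded force are uniformly ultimately
bounded. -/
theorem exists_ultimate_bound_mass_spring_damper {k : ℕ} [NeZero k]
    {M B S : Matrix (Fin k) (Fin k) ℝ} (hM : M.PosDef) (hB : B.PosDef) (hS : S.PosDef) (F : ℝ) :
    ∃ b, 0 < b ∧ ∀ a : ℝ, ∃ T, 0 ≤ T ∧ ∀ e v w f : ℝ → Vec k,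
      (∀ t, 0 ≤ t → HasDerivWithinAt e (v t) (Ici 0) t) →
      (∀ t, 0 ≤ t → HasDerivWithinAt v (w t) (Ici 0) t) →
      (∀ t, 0 ≤ t → act M (w t) + act B (v t) + act S (e t) = f t) →
      (∀ t, 0 ≤ t → ‖f t‖ ≤ F) → ‖e 0‖ ≤ a → ‖v 0‖ ≤ a → ∀ t, T ≤ t → ‖e t‖ ≤ b := by
  obtain ⟨ε, c, m, L, C, hc, hm, hL, hC, hV⟩ := exists_lyapunov hM hB hS F
  -- `C / c` is the limiting level of `V`; the extra `1` is the residual transient allowed after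
  -- `T`, so only `T` depends on `a`.
  refine ⟨Real.sqrt ((C / c + 1) / m), by positivity, fun a => ?_⟩
  have hlim : Filter.Tendsto (fun T => Real.exp (-(c * T)) * (2 * L * a ^ 2)) Filter.atTop
      (nhds 0) := by
    have h1 : Filter.Tendsto (fun T => -(c * T)) Filter.atTop Filter.atBot :=
      Filter.tendsto_neg_atTop_atBot.comp (Filter.tendsto_id.const_mul_atTop hc)
    simpa using (Real.tendsto_exp_atBot.comp h1).mul_const (2 * L * a ^ 2)
  obtain ⟨T, hT⟩ := Filter.eventually_atTop.1 (hlim.eventually_le_const one_pos)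
  refine ⟨max T 0, le_max_right _ _, fun e v w f he hv hdyn hf he0 hv0 t ht => ?_⟩
  have ht0 : 0 ≤ t := (le_max_right _ _).trans ht
  set V : ℝ → ℝ := fun t => 1 / 2 * inner ℝ (v t) (act M (v t))
    + 1 / 2 * inner ℝ (e t) (act S (e t)) + ε * inner ℝ (e t) (act M (v t)) with hVdef
  have hMs : Mᵀ = M := by simpa using hM.isHermitian.eq
  have hSs : Sᵀ = S := by simpa using hS.isHermitian.eq
  have hVd : ∀ s ∈ Icc 0 t, HasDerivWithinAt (fun s => V s - C / c)
      (inner ℝ (v s) (act M (w s)) + inner ℝ (v s) (act S (e s))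
        + ε * (inner ℝ (v s) (act M (v s)) + inner ℝ (e s) (act M (w s)))) (Ici 0) s := by
    intro s hs
    have h1 := (hv s hs.1).inner ℝ (hasDerivWithinAt_act M (hv s hs.1))
    have h2 := (he s hs.1).inner ℝ (hasDerivWithinAt_act S (he s hs.1))
    have h3 := (he s hs.1).inner ℝ (hasDerivWithinAt_act M (hv s hs.1))
    refine ((((h1.const_mul (1 / 2)).add (h2.const_mul (1 / 2))).add
      (h3.const_mul ε)).sub_const (C / c)).congr_deriv ?_
    have s1 : inner ℝ (w s) (act M (v s)) = inner ℝ (v s) (act M (w s)) := by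
      rw [inner_act, hMs, real_inner_comm]
    have s2 : inner ℝ (e s) (act S (v s)) = inner ℝ (v s) (act S (e s)) := by
      rw [inner_act, hSs, real_inner_comm]
    rw [s1, s2]
    ring
  have hdecay := le_exp_mul_of_deriv_le (c := c) ht0 hVd fun s hs => by
    have := (hV (e s) (v s)).2.2 (w s) (f s) (hdyn s hs.1) (hf s hs.1)
    refine this.trans_eq ?_
    simp only [hVdef]
    field_simp
    ring
  have h0 : V 0 ≤ 2 * L * a ^ 2 := by
    have h1 := (hV (e 0) (v 0)).2.1
    have h2 := pow_le_pow_left₀ (norm_nonneg _) he0 2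
    have h3 := pow_le_pow_left₀ (norm_nonneg _) hv0 2
    refine h1.trans ?_
    nlinarith
  have h1 : Real.exp (-(c * t)) * (V 0 - C / c) ≤ 1 := by
    refine le_trans ?_ (hT t ((le_max_left _ _).trans ht))
    gcongr
    have : 0 ≤ C / c := by positivity
    linarith
  have h2 : m * ‖e t‖ ^ 2 ≤ V t := (hV (e t) (v t)).1
  refine Real.le_sqrt_of_sq_le ?_
  rw [le_div_iff₀' hm]
  linarith

namespace Signals

variable {n R m : ℕ}

theorem uniformlyUltimatelyBounded_trackErr (P : Plant n) (K : Controller n R m)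
    (A : Uncertainty P K) (zb Fb : ℝ) :
    UniformlyUltimatelyBounded (fun X : Signals n R m => X.IsRun A zb Fb)
      (fun X => max ‖X.trackErr P 0‖ ‖X.trackErrd P 0‖) (fun X t => X.trackErr P t) := by
  obtain ⟨H₁, hH₁⟩ := A.Om_compact.exists_bound_of_continuousOn
    (f := fun ξ => P.hz ξ.1) (P.hz_smooth.continuous.comp continuous_fst).continuousOn
  obtain ⟨H₂, hH₂⟩ := A.Om_compact.exists_bound_of_continuousOn
    (f := fun ξ => act (P.J ξ.1) ξ.2.1) (continuousOn_act
      (P.continuous_J.comp continuous_fst).continuousOn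
      (continuous_fst.comp continuous_snd).continuousOn)
  obtain ⟨b, hb, hbound⟩ := exists_ultimate_bound_mass_spring_damper K.Md_posDef K.Bd_posDef
    K.Kd_posDef Fb
  refine ⟨b + |zb| + |H₁|, by positivity, fun a _ => ?_⟩
  -- This bounds the initial position and velocity of `zdes - zimp`: desired trajectory, tracking
  -- error and compact-domain bound added up.
  obtain ⟨T, hT, hT'⟩ := hbound (|zb| + (a + max H₁ H₂))
  refine ⟨T, hT, fun X hX hinit t ht => ?_⟩
  have hq : ∀ t, 0 ≤ t → ‖P.hz (X.q t)‖ ≤ H₁ := fun t ht => hH₁ (X.xi K t) (hX.bounded.xi_mem t ht)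
  have hqd : ∀ t, 0 ≤ t → ‖act (P.J (X.q t)) (X.qd t)‖ ≤ H₂ := fun t ht =>
    hH₂ (X.xi K t) (hX.bounded.xi_mem t ht)
  have hz := hX.scenario.zdes_bdd
  have he := hT' (fun t => X.zdes t - X.zimp t) (fun t => X.zdesd t - X.zimpd t)
    (fun t => X.zdesdd t - X.zimpdd t) X.Fh
    (fun t ht => (hX.scenario.zdes_deriv t ht).sub (hX.closedLoop.zimp_deriv t ht))
    (fun t ht => (hX.scenario.zdesd_deriv t ht).sub (hX.closedLoop.zimpd_deriv t ht))
    hX.closedLoop.impedance hX.scenario.Fh_bdd ?_ ?_ t ht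
  · have ht0 := hT.trans ht
    have e1 : X.trackErr P t = X.zdes t - P.hz (X.q t) - (X.zdes t - X.zimp t) := by
      simp only [trackErr]; abel
    change ‖X.trackErr P t‖ ≤ _
    rw [e1]
    linarith [norm_sub_le (X.zdes t - P.hz (X.q t)) (X.zdes t - X.zimp t),
      norm_sub_le (X.zdes t) (P.hz (X.q t)), (hz t ht0).1, hq t ht0, le_abs_self zb,
      le_abs_self H₁]
  · have e1 : X.zdes 0 - X.zimp 0 = X.zdes 0 - (X.trackErr P 0 + P.hz (X.q 0)) := by
      simp only [trackErr]; abel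
    rw [e1]
    linarith [norm_sub_le (X.zdes 0) (X.trackErr P 0 + P.hz (X.q 0)),
      norm_add_le (X.trackErr P 0) (P.hz (X.q 0)), (hz 0 le_rfl).1, hq 0 le_rfl, le_abs_self zb,
      le_max_left H₁ H₂, (le_max_left _ _).trans hinit]
  · have e1 : X.zdesd 0 - X.zimpd 0 =
        X.zdesd 0 - (X.trackErrd P 0 + act (P.J (X.q 0)) (X.qd 0)) := by
      simp only [trackErrd]; abel
    rw [e1]
    linarith [norm_sub_le (X.zdesd 0) (X.trackErrd P 0 + act (P.J (X.q 0)) (X.qd 0)),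
      norm_add_le (X.trackErrd P 0) (act (P.J (X.q 0)) (X.qd 0)), (hz 0 le_rfl).2.1,
      hqd 0 le_rfl, le_abs_self zb, le_max_right H₁ H₂, (le_max_right _ _).trans hinit]

end Signals

end SafeImpedance

end

theorem theorem1 {n R m : ℕ} (P : Plant n) (K : Controller n R m) (A : Uncertainty P K)
    (zb Fb : ℝ) :
    (∀ X : Signals n R m, X.IsRun A zb Fb →
      ∀ t, 0 ≤ t → ∀ i, K.tmin i ≤ X.u P K t i ∧ X.u P K t i ≤ K.tmax i) ∧
    (∀ X : Signals n R m, X.IsRun A zb Fb →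
      X.x 0 ∈ K.Cstar → ∀ t, 0 ≤ t → X.x t ∈ K.Cstar) ∧
    UniformlyUltimatelyBounded (fun X : Signals n R m => X.IsRun A zb Fb)
      (fun X => max ‖X.trackErr P 0‖ ‖X.trackErrd P 0‖) (fun X t => X.trackErr P t) :=
  ⟨fun _ h _ ht i => h.torque_mem ht i, fun _ h h0 _ ht => h.mem_Cstar h0 ht,
    Signals.uniformlyUltimatelyBounded_trackErr P K A zb Fb⟩
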